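/- **Setting.** Fix an integer $p\ge 0$. Consider a sequence of finite populations $U=\{1,\dots,N\}$ with $N\to\infty$, each with fixed (non-random) values $y_i\in\mathbb R$, $\bm x_i\in\mathbb R^p$ and a probability sampling design, i.e. a probability distribution on the subsets $A\subseteq U$ (values and design may change along the sequence, and probabilities refer to the design). Write $n=|A|$, $\pi_i=P(i\in A)$, $\pi_{ij}=P(i\in A,\,j\in A)$, $d_i=\pi_i^{-1}$. Let $\mathcal V\subseteq\mathbb R$ be an interval, $G:\mathcal V\to\mathbb R$, $g=G'$, and $\bm z_i=(\bm x_i^\top,g(d_i))^\top\in\mathbb R^{p+1}$. For a sample $A$, the calibration problem is to minimize $\sum_{i\in A}G(\omega_i)$ over all $\bm\omega=(\omega_i)_{i\in A}\in\mathcal V^n$ with $\sum_{i\in A}\omega_i\bm z_i=\sum_{i\in U}\bm z_i$, that is, with the benchmarking constraint $\sum_{i\in A}\omega_i\bm x_i=\sum_{i\in U}\bm x_i$ and the debiasing constraint $\sum_{i\in A}\omega_i g(d_i)=\sum_{i\in U}g(d_i)$. Let $\hat{\bm\omega}$ be its solution (chosen arbitrarily when there is none) and $\hat\theta_{\rm cal}=\sum_{i\in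 A}\hat\omega_i y_i$, $\theta_N=\sum_{i\in U}y_i$. **Assumptions.** 1. $G$ is strictly convex and twice continuously differentiable on $\mathcal V$, and $g'=G''>0$ on the interior of $\mathcal V$. 2. There are constants $c_1,c_2>0$ with $c_1^{-1},c_2^{-1}$ in the interior of $\mathcal V$ such that $c_1<\pi_i<c_2$ for all $i\in U$ and all populations of the sequence. 3. $\limsup_{N\to\infty}N\max_{i\ne j}|\pi_{ij}-\pi_i\pi_j|<\infty$. 4. $\bm\Sigma_{\bm z}=\lim_{N\to\infty}N^{-1}\sum_{i\in U}\bm z_i\bm z_i^\top$ exists and is positive definite, and $\limsup_{N\to\infty}N^{-1}\sum_{i\in U}\|(y_i,\bm x_i^\top)\|^4<\infty$. **Theorem 1 (Design consistency).** Under these assumptions, the solution $\hat{\bm\omega}$ of the calibration problem exists and is unique with probability tending to $1$. Furthermore, the matrix $\sum_{i\in U}\pi_i\bm z_i\bm z_i^\top/g'(d_i)$ is invertible for all sufficiently late populations of the sequence, and $$\hat\theta_{\rm cal}=\hat\theta_{{\rm greg},\ell}+o_p(n^{-1/2}N),\qquad \hat\theta_{{\rm greg},\ell}=\sum_{i\in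 U}\bm z_i^\top\bm\gamma_N+\sum_{i\in A}\frac1{\pi_i}\left(y_i-\bm z_i^\top\bm\gamma_N\right),$$ $$\bm\gamma_N=\Big\{\sum_{i\in U}\frac{\pi_i\bm z_i\bm z_i^\top}{g'(d_i)}\Big\}^{-1}\sum_{i\in U}\frac{\pi_i\bm z_iy_i}{g'(d_i)}.$$ In particular $\hat\theta_{\rm cal}$ is design-consistent: $N^{-1}(\hat\theta_{\rm cal}-\theta_N)\to0$ in probability. -/

import Mathlib

open Filter Topology Matrix

noncomputable section

/-- A finite population `U = {1, …, N}` with study variable `y`, `p`-dimensional auxiliary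
variable `x`, and a probability sampling design: a probability distribution on the set of all
samples `A ⊆ U`.  The values `y`, `x` are fixed; only the sample is random. -/
structure Survey (N p : ℕ) where
  /-- study variable -/
  y : Fin N → ℝ
  /-- auxiliary variables -/
  x : Fin N → Fin p → ℝ
  /-- sampling design -/
  design : PMF (Finset (Fin N))

namespace Survey

variable {N p : ℕ} (S : Survey N p) (G : ℝ → ℝ)

/-- Probability, under the sampling design, that the sample belongs to `E`. -/
def prob (E : Set (Finset (Fin N))) : ℝ := (S.design.toOuterMeasure E).toReal

/-- First-order inclusion probability `π_i`. -/
def incl (i : Fin N) : ℝ := S.prob {A | i ∈ A}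

/-- Joint inclusion probability `π_{ij}`. -/
def incl₂ (i j : Fin N) : ℝ := S.prob {A | i ∈ A ∧ j ∈ A}

/-- Design weight `d_i = 1 / π_i`. -/
def d (i : Fin N) : ℝ := (S.incl i)⁻¹

/-- The augmented covariate `z_i = (x_i, g(d_i)) ∈ ℝ^{p+1}`, where `g = G'`. -/
def z (i : Fin N) : Fin (p + 1) → ℝ :=
  Fin.snoc (α := fun _ => ℝ) (S.x i) (deriv G (S.d i))

/-- The population total `θ_N = ∑_{i ∈ U} y_i`. -/
def total : ℝ := ∑ i, S.y i

/-- Weights on the sample `A`, all lying in `V`, that satisfy the benchmarking and the debiasing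
constraint `∑_{i ∈ A} ω_i z_i = ∑_{i ∈ U} z_i`. -/
def feasible (V : Set ℝ) (A : Finset (Fin N)) : Set (A → ℝ) :=
  {ω | (∀ i, ω i ∈ V) ∧ ∑ i : A, ω i • S.z G i = ∑ i, S.z G i}

/-- `ω` solves the calibration problem: it minimizes `∑_{i ∈ A} G(ω_i)` over the feasible
weights. -/
def IsSolution (V : Set ℝ) (A : Finset (Fin N)) (ω : A → ℝ) : Prop :=
  ω ∈ S.feasible G V A ∧ IsMinOn (fun ω : A → ℝ => ∑ i, G (ω i)) (S.feasible G V A) ω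

/-- The calibration weights `ω̂`: a solution of the calibration problem if there is one
(arbitrary otherwise). -/
def calWeights (V : Set ℝ) (A : Finset (Fin N)) : A → ℝ :=
  Classical.epsilon (S.IsSolution G V A)

/-- The calibration estimator `θ̂_cal = ∑_{i ∈ A} ω̂_i y_i`. -/
def calEstimator (V : Set ℝ) (A : Finset (Fin N)) : ℝ :=
  ∑ i : A, S.calWeights G V A i * S.y i

/-- The matrix `∑_{i ∈ U} z_i z_iᵀ`. -/
def zGram : Matrix (Fin (p + 1)) (Fin (p + 1)) ℝ :=
  ∑ i, vecMulVec (S.z G i) (S.z G i)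

/-- The matrix `∑_{i ∈ U} π_i z_i z_iᵀ / g'(d_i)`. -/
def regGram : Matrix (Fin (p + 1)) (Fin (p + 1)) ℝ :=
  ∑ i, (S.incl i / deriv (deriv G) (S.d i)) • vecMulVec (S.z G i) (S.z G i)

/-- The regression coefficient
`γ_N = {∑_{i ∈ U} π_i z_i z_iᵀ / g'(d_i)}⁻¹ ∑_{i ∈ U} π_i z_i y_i / g'(d_i)`. -/
def gammaN : Fin (p + 1) → ℝ :=
  (S.regGram G)⁻¹ *ᵥ ∑ i, (S.incl i / deriv (deriv G) (S.d i) * S.y i) • S.z G i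

/-- The estimator `∑_{i ∈ U} z_iᵀ γ_N + ∑_{i ∈ A} (y_i - z_iᵀ γ_N) / π_i`. -/
def gregEstimator (A : Finset (Fin N)) : ℝ :=
  ∑ i, S.z G i ⬝ᵥ S.gammaN G + ∑ i ∈ A, (S.y i - S.z G i ⬝ᵥ S.gammaN G) / S.incl i

end Survey

/-- Convergence to `0` in probability, along a sequence of surveys, of statistics `T ν` of the
samples. -/
def TendstoZeroInProb {p : ℕ} {N : ℕ → ℕ} (S : ∀ ν, Survey (N ν) p)
    (T : ∀ ν, Finset (Fin (N ν)) → ℝ) : Prop :=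
  ∀ ε > 0, Tendsto (fun ν => (S ν).prob {A | ε < |T ν A|}) atTop (𝓝 0)

end

/-! Lagrange duality turns calibration into one equation in `p + 1` unknowns. A stationary point has
`g(ω_i) = ⟨z_i, λ⟩`. Since `g(d_i)` is the last coordinate of `z_i`, the last basis vector is the
multiplier of the design weights themselves. Write `λ = e_last + δ` and `ω_i = f(g(d_i) + ⟨z_i,
δ⟩)`, with `f` inverse to `g` near the design weights and extended to a bi-Lipschitz bijection of
the line. The constraint becomes the vanishing of a globally Lipschitz, strongly monotone map of
`δ`, so a solution always exists once the sample Gram matrix is bounded below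
(`exists_dual_solution`).

Four centred sample sums must be of order `√N`: the Horvitz–Thompson error of `z`, the sample Gram
matrix, the score `e_i z_i / g'(d_i)` and the weighted residual `d_i e_i`, where `e_i = y_i - ⟨z_i,
γ_N⟩`. Weak dependence and fourth moments give this by Chebyshev (`prob_not_good_le`). On such
samples the monotonicity constant has order `N` and the defect at `δ = 0` has order `√N`, so `‖δ‖ =
O(N^{-1/2})`. As `max ‖z_i‖ = O(N^{1/4})`, all shifts `⟨z_i, δ⟩` tend to zero uniformly. The weights
therefore stay where `f` really inverts `g`, inside `V`, and strict convexity makes them the unique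
minimizer (`existsUnique_isSolution`).

By the constraint, the calibration estimator minus the regression estimator equals `∑_A (ω_i - d_i)
e_i`. Its linear part is the inner product of the score sum with `δ`; the normal equation centres
that sum, so this part is `O(1)`. The Taylor remainder is `o(√N)` because the expansion of `f` is
uniform (`exists_inverse_expansion`, `calibration_of_good`). Since `n ≤ N`, this gives the stated
rate. -/

/-! ### Monotone equations, inverses of the derivative, and the dual equation -/

/-- A strongly monotone Lipschitz map of a Hilbert space has a zero. -/
theorem exists_zero_of_strongly_monotone {E : Type*} [NormedAddCommGroup E]
    [InnerProductSpace ℝ E] [CompleteSpace E] (H : E → E) {c L : ℝ} (hc : 0 < c)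
    (hmono : ∀ x y, c * ‖x - y‖ ^ 2 ≤ inner ℝ (H x - H y) (x - y))
    (hlip : ∀ x y, ‖H x - H y‖ ≤ L * ‖x - y‖) : ∃ x, H x = 0 := by
  obtain ⟨M, hM0, hcM, hM⟩ : ∃ M : ℝ, 0 < M ∧ c ≤ M ∧ ∀ x y, ‖H x - H y‖ ≤ M * ‖x - y‖ :=
    ⟨max L c, lt_max_of_lt_right hc, le_max_right _ _, fun x y =>
      (hlip x y).trans (mul_le_mul_of_nonneg_right (le_max_left _ _) (norm_nonneg _))⟩
  -- Zeros of `H` are the fixed points of `x - s • H x`. This step size minimizes the squared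
  -- contraction bound `1 - 2sc + s²M²`, with value `1 - sc`; `c ≤ M` makes it nonnegative.
  set s : ℝ := c / M ^ 2 with hs
  have hs0 : 0 < s := by positivity
  have hsM : s * M ^ 2 = c := by rw [hs]; field_simp
  have hk : s * c ≤ 1 := by
    rw [hs, div_mul_eq_mul_div, div_le_one (by positivity)]
    nlinarith
  have key : ∀ x y, ‖(x - s • H x) - (y - s • H y)‖ ^ 2 ≤ (1 - s * c) * ‖x - y‖ ^ 2 := by
    intro x y
    have h1 : (x - s • H x) - (y - s • H y) = (x - y) - s • (H x - H y) := by
      rw [smul_sub]; abel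
    rw [h1, norm_sub_sq_real, inner_smul_right, norm_smul, Real.norm_of_nonneg hs0.le,
      real_inner_comm]
    have h2 := mul_le_mul_of_nonneg_left (hmono x y) hs0.le
    have h3 : ‖H x - H y‖ ^ 2 ≤ M ^ 2 * ‖x - y‖ ^ 2 := by
      rw [← mul_pow]; exact pow_le_pow_left₀ (norm_nonneg _) (hM x y) 2
    have h4 := mul_le_mul_of_nonneg_left h3 (sq_nonneg s)
    have h5 : s ^ 2 * (M ^ 2 * ‖x - y‖ ^ 2) = s * c * ‖x - y‖ ^ 2 := by rw [← hsM]; ring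
    rw [h5] at h4
    rw [mul_pow]
    linarith
  have hcontr : ContractingWith (Real.toNNReal (√(1 - s * c))) (fun x => x - s • H x) := by
    constructor
    · rw [Real.toNNReal_lt_one, Real.sqrt_lt' one_pos]
      have : 0 < s * c := by positivity
      linarith
    · refine LipschitzWith.of_dist_le_mul fun x y => ?_
      rw [dist_eq_norm, dist_eq_norm, Real.coe_toNNReal _ (Real.sqrt_nonneg _)]
      refine abs_le_of_sq_le_sq' ?_ (by positivity) |>.2
      rw [mul_pow, Real.sq_sqrt (by linarith)]
      exact key x y
  refine ⟨hcontr.fixedPoint, ?_⟩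
  have h := hcontr.fixedPoint_isFixedPt
  have h' : hcontr.fixedPoint - s • H hcontr.fixedPoint = hcontr.fixedPoint := h
  rw [sub_eq_self] at h'
  exact (smul_eq_zero.1 h').resolve_left hs0.ne'

/-- A function with bounded positive slopes on a compact interval has a left inverse on it with
slopes that are bounded and bounded away from zero on the whole line. -/
theorem exists_biLipschitz_leftInverse {g : ℝ → ℝ} {a b m M : ℝ} (hab : a ≤ b) (hm : 0 < m)
    (hg : ∀ w ∈ Set.Icc a b, ∀ w' ∈ Set.Icc a b, w ≤ w' →
      m * (w' - w) ≤ g w' - g w ∧ g w' - g w ≤ M * (w' - w)) :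
    ∃ (f : ℝ → ℝ) (κ L : ℝ), 0 < κ ∧ 0 < L ∧
      (∀ u u', u ≤ u' → κ * (u' - u) ≤ f u' - f u ∧ f u' - f u ≤ L * (u' - u)) ∧
      ∀ w ∈ Set.Icc a b, f (g w) = w := by
  let P : ℝ → ℝ := fun w => max a (min b w)
  have hP : ∀ w, P w ∈ Set.Icc a b := fun w => ⟨le_max_left _ _, max_le hab (min_le_left _ _)⟩
  have hPmono : ∀ w w', w ≤ w' → P w ≤ P w' ∧ P w' - P w ≤ w' - w := by
    intro w w' h
    simp only [P]
    constructor
    · gcongr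
    · simp only [max_def, min_def]; split_ifs <;> linarith
  have hPid : ∀ w ∈ Set.Icc a b, P w = w := fun w hw => by
    simp only [P, min_eq_right hw.2, max_eq_right hw.1]
  -- `g` is continued with slope 1 outside `[a, b]`, so slopes lie between `min m 1` and `max M 1`
  -- everywhere and `h` is a bijection of the line. The required `f` is its inverse.
  let h : ℝ → ℝ := fun w => g (P w) + (w - P w)
  let m' := min m 1
  let M' := max M 1
  have hm' : 0 < m' := lt_min hm one_pos
  have hM' : 0 < M' := lt_max_of_lt_right one_pos
  have hh : ∀ w w', w ≤ w' → m' * (w' - w) ≤ h w' - h w ∧ h w' - h w ≤ M' * (w' - w) := by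
    intro w w' hw
    obtain ⟨h1, h2⟩ := hPmono w w' hw
    obtain ⟨h3, h4⟩ := hg _ (hP w) _ (hP w') h1
    simp only [h]
    have e1 : m' * (P w' - P w) ≤ m * (P w' - P w) :=
      mul_le_mul_of_nonneg_right (min_le_left _ _) (by linarith)
    have e2 : m' * ((w' - w) - (P w' - P w)) ≤ 1 * ((w' - w) - (P w' - P w)) :=
      mul_le_mul_of_nonneg_right (min_le_right _ _) (by linarith)
    have e3 : M * (P w' - P w) ≤ M' * (P w' - P w) :=
      mul_le_mul_of_nonneg_right (le_max_left _ _) (by linarith)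
    have e4 : 1 * ((w' - w) - (P w' - P w)) ≤ M' * ((w' - w) - (P w' - P w)) :=
      mul_le_mul_of_nonneg_right (le_max_right _ _) (by linarith)
    constructor <;> linarith
  have hmono : StrictMono h := by
    intro w w' hw
    have := (hh w w' hw.le).1
    have : 0 < m' * (w' - w) := mul_pos hm' (by linarith)
    linarith
  have hcont : Continuous h := by
    have : LipschitzWith (Real.toNNReal M') h := by
      refine LipschitzWith.of_dist_le_mul fun x y => ?_
      rw [Real.coe_toNNReal _ hM'.le, Real.dist_eq, Real.dist_eq]
      rcases le_total x y with hxy | hxy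
      · rw [abs_sub_comm, abs_sub_comm x, abs_of_nonneg (sub_nonneg.2 (hmono.monotone hxy)),
          abs_of_nonneg (sub_nonneg.2 hxy)]
        exact (hh x y hxy).2
      · rw [abs_of_nonneg (sub_nonneg.2 (hmono.monotone hxy)), abs_of_nonneg (sub_nonneg.2 hxy)]
        exact (hh y x hxy).2
    exact this.continuous
  have htop : Tendsto h atTop atTop := by
    refine tendsto_atTop_mono' _ ((eventually_ge_atTop 0).mono fun w hw => ?_)
      (tendsto_atTop_add_const_left _ (h 0) (tendsto_id.const_mul_atTop hm'))
    have := (hh 0 w hw).1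
    simp only [id]; linarith
  have hbot : Tendsto h atBot atBot := by
    refine tendsto_atBot_mono' _ ((eventually_le_atBot 0).mono fun w hw => ?_)
      (tendsto_atBot_add_const_left _ (h 0) (tendsto_id.const_mul_atBot hm'))
    have := (hh w 0 hw).1
    simp only [id]; linarith
  have hsurj : Function.Surjective h := hcont.surjective htop hbot
  let o := hmono.orderIsoOfSurjective h hsurj
  have ho : ∀ u, h (o.symm u) = u := fun u => o.apply_symm_apply u
  refine ⟨o.symm, M'⁻¹, m'⁻¹, inv_pos.2 hM', inv_pos.2 hm', fun u u' huu => ?_, fun w hw => ?_⟩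
  · have h1 := hh _ _ (o.symm.monotone huu)
    rw [ho, ho] at h1
    rw [inv_mul_le_iff₀ hM', le_inv_mul_iff₀ hm']
    exact ⟨h1.2, h1.1⟩
  · have : h w = g w := by simp only [h, hPid w hw]; ring
    rw [← this]
    exact o.symm_apply_apply w

/-- Slopes of a function between the bounds of its derivative. -/
theorem slope_bounds_of_hasDerivAt {g g' : ℝ → ℝ} {a b m M : ℝ}
    (hg : ∀ w ∈ Set.Icc a b, HasDerivAt g (g' w) w)
    (hm : ∀ w ∈ Set.Icc a b, m ≤ g' w ∧ g' w ≤ M) :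
    ∀ w ∈ Set.Icc a b, ∀ w' ∈ Set.Icc a b, w ≤ w' →
      m * (w' - w) ≤ g w' - g w ∧ g w' - g w ≤ M * (w' - w) := by
  intro w hw w' hw' h
  rcases h.eq_or_lt with rfl | h
  · simp
  have hsub : Set.Icc w w' ⊆ Set.Icc a b := Set.Icc_subset_Icc hw.1 hw'.2
  obtain ⟨ξ, hξ, e⟩ := exists_hasDerivAt_eq_slope g g' h
    (fun x hx => (hg x (hsub hx)).continuousAt.continuousWithinAt)
    (fun x hx => hg x (hsub (Set.Ioo_subset_Icc_self hx)))
  obtain ⟨h1, h2⟩ := hm ξ (hsub (Set.Ioo_subset_Icc_self hξ))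
  rw [eq_div_iff (by linarith)] at e
  rw [← e]
  constructor
  · exact mul_le_mul_of_nonneg_right h1 (by linarith)
  · exact mul_le_mul_of_nonneg_right h2 (by linarith)

/-- The uniform first-order behaviour of an inverse `f` of `g` near the points `g t`,
`t ∈ [a, b]`, where `g` has a continuous positive derivative on a neighbourhood of `[a, b]`. -/
theorem exists_inverse_expansion {g g' : ℝ → ℝ} {a b η : ℝ} (hab : a ≤ b) (hη : 0 < η)
    (hg : ∀ w ∈ Set.Icc (a - η) (b + η), HasDerivAt g (g' w) w)
    (hg' : ContinuousOn g' (Set.Icc (a - η) (b + η)))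
    (hpos : ∀ w ∈ Set.Icc (a - η) (b + η), 0 < g' w) :
    ∃ (f : ℝ → ℝ) (κ L : ℝ), 0 < κ ∧ 0 < L ∧
      (∀ u u', κ * (u' - u) ^ 2 ≤ (f u' - f u) * (u' - u) ∧ |f u' - f u| ≤ L * |u' - u|) ∧
      (∀ w ∈ Set.Icc a b, f (g w) = w) ∧
      ∀ ε > 0, ∃ τ > 0, ∀ w ∈ Set.Icc a b, ∀ t, |t| ≤ τ →
        f (g w + t) ∈ Set.Icc (a - η) (b + η) ∧ g (f (g w + t)) = g w + t ∧
        |f (g w + t) - w - t / g' w| ≤ ε * |t| := by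
  have hne : (Set.Icc (a - η) (b + η)).Nonempty := ⟨a, by constructor <;> linarith⟩
  obtain ⟨w₀, hw₀, hmin⟩ := isCompact_Icc.exists_isMinOn hne hg'
  obtain ⟨w₁, hw₁, hmax⟩ := isCompact_Icc.exists_isMaxOn hne hg'
  have hslope := slope_bounds_of_hasDerivAt hg
    (fun w hw => ⟨isMinOn_iff.1 hmin w hw, isMaxOn_iff.1 hmax w hw⟩)
  obtain ⟨f, κ, L, hκ, hL, hf, hfg⟩ :=
    exists_biLipschitz_leftInverse (by linarith) (hpos _ hw₀) hslope
  have hf2 : ∀ u u', κ * (u' - u) ^ 2 ≤ (f u' - f u) * (u' - u) ∧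
      |f u' - f u| ≤ L * |u' - u| := by
    intro u u'
    rcases le_total u u' with h | h
    · obtain ⟨h1, h2⟩ := hf u u' h
      have h0 : 0 ≤ u' - u := sub_nonneg.2 h
      have : 0 ≤ κ * (u' - u) := by positivity
      rw [abs_of_nonneg h0, abs_of_nonneg (by linarith)]
      exact ⟨by nlinarith, h2⟩
    · obtain ⟨h1, h2⟩ := hf u' u h
      have h0 : 0 ≤ u - u' := sub_nonneg.2 h
      have : 0 ≤ κ * (u - u') := by positivity
      rw [abs_sub_comm, abs_sub_comm u', abs_of_nonneg h0, abs_of_nonneg (by linarith)]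
      exact ⟨by nlinarith, h2⟩
  have hinj : Function.Injective f := by
    intro u u' h
    have h1 := (hf2 u u').1
    rw [h, sub_self, zero_mul] at h1
    have : (u' - u) ^ 2 ≤ 0 := by
      by_contra hcon
      push Not at hcon
      have := mul_pos hκ hcon
      linarith
    have := pow_eq_zero_iff (two_ne_zero) |>.1 (le_antisymm this (sq_nonneg _))
    linarith
  have hsub : Set.Icc a b ⊆ Set.Icc (a - η) (b + η) :=
    Set.Icc_subset_Icc (by linarith) (by linarith)
  refine ⟨f, κ, L, hκ, hL, hf2, fun w hw => hfg w (hsub hw), fun ε hε => ?_⟩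
  have hinv : ContinuousOn (fun w => (g' w)⁻¹) (Set.Icc (a - η) (b + η)) :=
    hg'.inv₀ fun w hw => (hpos w hw).ne'
  obtain ⟨ρ, hρ, hunif⟩ := Metric.uniformContinuousOn_iff.1
    (isCompact_Icc.uniformContinuousOn_of_continuous hinv) ε hε
  -- A shift by `t` moves `f` by at most `L|t|`: the bound `η` keeps the value in the larger
  -- interval, and `ρ / 2` keeps it strictly within the modulus of continuity of `1 / g'`.
  refine ⟨min η (ρ / 2) / L, div_pos (lt_min hη (by linarith)) hL, fun w hw t ht => ?_⟩
  rw [le_div_iff₀ hL] at ht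
  have hwJ := hsub hw
  have h1 := (hf2 (g w) (g w + t)).2
  rw [hfg w hwJ, add_sub_cancel_left] at h1
  set v := f (g w + t) with hv
  have hvη : |v - w| ≤ η := h1.trans (by linarith [min_le_left η (ρ / 2)])
  have hvρ : |v - w| < ρ := by
    have := min_le_right η (ρ / 2)
    linarith
  have hvJ : v ∈ Set.Icc (a - η) (b + η) := by
    rw [abs_le] at hvη
    constructor <;> linarith [hw.1, hw.2]
  have hgv : g v = g w + t := hinj (by rw [hfg v hvJ])
  refine ⟨hvJ, hgv, ?_⟩
  -- Mean value theorem between `w` and `v`. The remainder is then `(1 / g' ξ - 1 / g' w) t`, which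
  -- uniform continuity controls.
  obtain ⟨ξ, hξJ, hξ, e⟩ : ∃ ξ ∈ Set.Icc (a - η) (b + η), |ξ - w| < ρ ∧
      t = g' ξ * (v - w) := by
    rcases lt_trichotomy w v with h | h | h
    · have hs : Set.Icc w v ⊆ Set.Icc (a - η) (b + η) := Set.Icc_subset_Icc hwJ.1 hvJ.2
      obtain ⟨ξ, hξ, e⟩ := exists_hasDerivAt_eq_slope g g' h
        (fun x hx => (hg x (hs hx)).continuousAt.continuousWithinAt)
        (fun x hx => hg x (hs (Set.Ioo_subset_Icc_self hx)))
      rw [eq_div_iff (by linarith), hgv] at e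
      refine ⟨ξ, hs (Set.Ioo_subset_Icc_self hξ), ?_, by linarith⟩
      rw [abs_lt] at hvρ ⊢
      constructor <;> linarith [hξ.1, hξ.2]
    · refine ⟨w, hwJ, by simpa using hρ, ?_⟩
      rw [← h] at hgv ⊢
      simp; linarith
    · have hs : Set.Icc v w ⊆ Set.Icc (a - η) (b + η) := Set.Icc_subset_Icc hvJ.1 hwJ.2
      obtain ⟨ξ, hξ, e⟩ := exists_hasDerivAt_eq_slope g g' h
        (fun x hx => (hg x (hs hx)).continuousAt.continuousWithinAt)
        (fun x hx => hg x (hs (Set.Ioo_subset_Icc_self hx)))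
      rw [eq_div_iff (by linarith), hgv] at e
      refine ⟨ξ, hs (Set.Ioo_subset_Icc_self hξ), ?_, by linarith⟩
      rw [abs_lt] at hvρ ⊢
      constructor <;> linarith [hξ.1, hξ.2]
  have hd := hunif ξ hξJ w hwJ (by rwa [Real.dist_eq])
  rw [Real.dist_eq] at hd
  have : v - w - t / g' w = ((g' ξ)⁻¹ - (g' w)⁻¹) * t := by
    have h3 : v - w = (g' ξ)⁻¹ * t := by
      rw [e, inv_mul_cancel_left₀ (hpos ξ hξJ).ne']
    rw [h3, div_eq_mul_inv]; ring
  rw [this, abs_mul]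
  exact mul_le_mul_of_nonneg_right hd.le (abs_nonneg _)

/-- Solution of the dual equation of the calibration problem, with a bound. -/
theorem exists_dual_solution {ι E : Type*} [NormedAddCommGroup E] [InnerProductSpace ℝ E]
    [CompleteSpace E] (A : Finset ι) (z : ι → E) (u : ι → ℝ) (T : E) {f : ℝ → ℝ} {κ L c : ℝ}
    (hκ : 0 < κ) (hL : 0 < L) (hc : 0 < c)
    (hf : ∀ u u', κ * (u' - u) ^ 2 ≤ (f u' - f u) * (u' - u) ∧ |f u' - f u| ≤ L * |u' - u|)
    (hA : ∀ v, c * ‖v‖ ^ 2 ≤ ∑ i ∈ A, inner ℝ (z i) v ^ 2) :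
    ∃ δ : E, ∑ i ∈ A, f (u i + inner ℝ (z i) δ) • z i = T ∧
      κ * c * ‖δ‖ ≤ ‖∑ i ∈ A, f (u i) • z i - T‖ := by
  let H : E → E := fun δ => ∑ i ∈ A, f (u i + inner ℝ (z i) δ) • z i - T
  have hsub : ∀ x y, H x - H y =
      ∑ i ∈ A, (f (u i + inner ℝ (z i) x) - f (u i + inner ℝ (z i) y)) • z i := by
    intro x y
    simp only [H, sub_sub_sub_cancel_right, ← Finset.sum_sub_distrib, sub_smul]
  have hmono : ∀ x y, (κ * c) * ‖x - y‖ ^ 2 ≤ inner ℝ (H x - H y) (x - y) := by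
    intro x y
    rw [hsub, sum_inner, mul_assoc]
    refine (mul_le_mul_of_nonneg_left (hA (x - y)) hκ.le).trans ?_
    rw [Finset.mul_sum]
    refine Finset.sum_le_sum fun i _ => ?_
    have := (hf (u i + inner ℝ (z i) y) (u i + inner ℝ (z i) x)).1
    rw [inner_smul_left, inner_sub_right]
    simpa using this
  have hlip : ∀ x y, ‖H x - H y‖ ≤ (∑ i ∈ A, L * ‖z i‖ ^ 2) * ‖x - y‖ := by
    intro x y
    rw [hsub, Finset.sum_mul]
    refine (norm_sum_le _ _).trans (Finset.sum_le_sum fun i _ => ?_)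
    rw [norm_smul, Real.norm_eq_abs]
    have h1 := (hf (u i + inner ℝ (z i) y) (u i + inner ℝ (z i) x)).2
    rw [add_sub_add_left_eq_sub, ← inner_sub_right] at h1
    have h2 := h1.trans (mul_le_mul_of_nonneg_left (abs_real_inner_le_norm (z i) (x - y)) hL.le)
    refine (mul_le_mul_of_nonneg_right h2 (norm_nonneg _)).trans_eq ?_
    ring
  obtain ⟨δ, hδ⟩ := exists_zero_of_strongly_monotone H (mul_pos hκ hc) hmono hlip
  refine ⟨δ, sub_eq_zero.1 hδ, ?_⟩
  have h0 : H 0 = ∑ i ∈ A, f (u i) • z i - T := by simp [H]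
  rw [← h0]
  -- Strong monotonicity between the zero `δ` and the origin, followed by Cauchy–Schwarz and
  -- division by `‖δ‖`, gives the a priori bound.
  have h1 := hmono δ 0
  rw [hδ, zero_sub, sub_zero] at h1
  have h2 := h1.trans ((le_abs_self _).trans (abs_real_inner_le_norm _ _))
  rw [norm_neg, pow_two, ← mul_assoc] at h2
  rcases (norm_nonneg δ).eq_or_lt with h | h
  · rw [← h]; simp
  · exact le_of_mul_le_mul_right h2 h

/-! ### Second moments of sample sums under the design -/

namespace Survey

variable {N p : ℕ} (S : Survey N p)

theorem sum_design_toReal : ∑ A, (S.design A).toReal = 1 := by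
  rw [← ENNReal.toReal_sum fun A _ => S.design.apply_ne_top A, ← tsum_fintype (L := .unconditional _),
    S.design.tsum_coe, ENNReal.toReal_one]

open Classical in
theorem prob_eq_sum (E : Set (Finset (Fin N))) :
    S.prob E = ∑ A, if A ∈ E then (S.design A).toReal else 0 := by
  rw [prob, PMF.toOuterMeasure_apply_fintype, ENNReal.toReal_sum]
  · refine Finset.sum_congr rfl fun A _ => ?_
    by_cases h : A ∈ E <;> simp [h]
  · intro A _
    by_cases h : A ∈ E <;> simp [h, S.design.apply_ne_top A]

theorem prob_nonneg (E : Set (Finset (Fin N))) : 0 ≤ S.prob E := ENNReal.toReal_nonneg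

theorem prob_mono {E F : Set (Finset (Fin N))} (h : E ⊆ F) : S.prob E ≤ S.prob F := by
  classical
  rw [prob_eq_sum, prob_eq_sum]
  refine Finset.sum_le_sum fun A _ => ?_
  by_cases h1 : A ∈ E
  · rw [if_pos h1, if_pos (h h1)]
  · rw [if_neg h1]; split_ifs <;> simp

theorem prob_add_prob_compl (E : Set (Finset (Fin N))) : S.prob E + S.prob Eᶜ = 1 := by
  classical
  rw [prob_eq_sum, prob_eq_sum, ← Finset.sum_add_distrib, ← S.sum_design_toReal]
  refine Finset.sum_congr rfl fun A _ => ?_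
  by_cases h1 : A ∈ E <;> simp [h1]

theorem prob_union_le (E F : Set (Finset (Fin N))) :
    S.prob (E ∪ F) ≤ S.prob E + S.prob F := by
  classical
  rw [prob_eq_sum, prob_eq_sum, prob_eq_sum, ← Finset.sum_add_distrib]
  refine Finset.sum_le_sum fun A _ => ?_
  by_cases h1 : A ∈ E <;> by_cases h2 : A ∈ F <;> simp [h1, h2]

theorem incl_le_one (i : Fin N) : S.incl i ≤ 1 := by
  have h1 := S.prob_add_prob_compl {A | i ∈ A}
  have h2 := S.prob_nonneg {A | i ∈ A}ᶜ
  rw [incl]; linarith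

theorem incl_eq_sum (i : Fin N) :
    S.incl i = ∑ A, (S.design A).toReal * if i ∈ A then 1 else 0 := by
  classical
  rw [incl, prob_eq_sum]
  exact Finset.sum_congr rfl fun A _ => by simp

theorem incl₂_eq_sum (i j : Fin N) :
    S.incl₂ i j =
      ∑ A, (S.design A).toReal * ((if i ∈ A then 1 else 0) * if j ∈ A then 1 else 0) := by
  classical
  rw [incl₂, prob_eq_sum]
  refine Finset.sum_congr rfl fun A _ => ?_
  by_cases h1 : i ∈ A <;> by_cases h2 : j ∈ A <;> simp [h1, h2]

theorem incl₂_self (i : Fin N) : S.incl₂ i i = S.incl i := by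
  simp [incl₂, incl]

/-- Markov's inequality for the sampling design. -/
theorem prob_mul_le_sum {X : Finset (Fin N) → ℝ} (hX : ∀ A, 0 ≤ X A) {t : ℝ} :
    S.prob {A | t < X A} * t ≤ ∑ A, (S.design A).toReal * X A := by
  classical
  rw [prob_eq_sum, Finset.sum_mul]
  refine Finset.sum_le_sum fun A _ => ?_
  by_cases h : t < X A
  · simp only [Set.mem_ofPred_eq, h, if_true]
    exact mul_le_mul_of_nonneg_left h.le ENNReal.toReal_nonneg
  · simp only [Set.mem_ofPred_eq, h, if_false, zero_mul]
    exact mul_nonneg ENNReal.toReal_nonneg (hX A)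

variable {E : Type*} [NormedAddCommGroup E] [InnerProductSpace ℝ E]

/-- The sum of `v` over the sample, centred at its expectation. -/
noncomputable def centredSum (v : Fin N → E) (A : Finset (Fin N)) : E :=
  ∑ i ∈ A, v i - ∑ i, S.incl i • v i

/-- The centred sum is a combination of centred inclusion indicators, whose covariances are `π_ij -
π_i π_j`. Values in an inner product space let vector and matrix sums be treated together. -/
theorem sum_design_mul_norm_centredSum_sq (v : Fin N → E) :
    ∑ A, (S.design A).toReal * ‖S.centredSum v A‖ ^ 2 =
      ∑ i, ∑ j, (S.incl₂ i j - S.incl i * S.incl j) * inner ℝ (v i) (v j) := by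
  have h1 : ∀ A, S.centredSum v A = ∑ i, ((if i ∈ A then 1 else 0) - S.incl i) • v i := by
    intro A
    simp [centredSum, sub_smul, Finset.sum_sub_distrib, ite_smul]
  have h2 : ∀ A, ‖S.centredSum v A‖ ^ 2 = ∑ i, ∑ j, (((if i ∈ A then 1 else 0) - S.incl i) *
      ((if j ∈ A then 1 else 0) - S.incl j)) * inner ℝ (v i) (v j) := by
    intro A
    rw [← real_inner_self_eq_norm_sq, h1, sum_inner]
    refine Finset.sum_congr rfl fun i _ => ?_
    rw [inner_sum]
    refine Finset.sum_congr rfl fun j _ => ?_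
    rw [real_inner_smul_left, real_inner_smul_right]; ring
  simp only [h2, Finset.mul_sum]
  rw [Finset.sum_comm]
  refine Finset.sum_congr rfl fun i _ => ?_
  rw [Finset.sum_comm]
  refine Finset.sum_congr rfl fun j _ => ?_
  simp only [← mul_assoc]
  rw [← Finset.sum_mul]
  congr 1
  have h3 : ∀ A, (S.design A).toReal * ((if i ∈ A then 1 else 0) - S.incl i) *
      ((if j ∈ A then 1 else 0) - S.incl j) =
      (S.design A).toReal * ((if i ∈ A then 1 else 0) * if j ∈ A then 1 else 0)
      - S.incl j * ((S.design A).toReal * if i ∈ A then 1 else 0)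
      - S.incl i * ((S.design A).toReal * if j ∈ A then 1 else 0)
      + S.incl i * S.incl j * (S.design A).toReal := fun A => by ring
  rw [Finset.sum_congr rfl fun A _ => h3 A, Finset.sum_add_distrib, Finset.sum_sub_distrib,
    Finset.sum_sub_distrib, ← Finset.mul_sum, ← Finset.mul_sum, ← Finset.mul_sum,
    ← incl_eq_sum, ← incl_eq_sum, ← incl₂_eq_sum, S.sum_design_toReal]
  ring

/-- Diagonal covariances are at most 1. The off-diagonal ones are at most `C / N`, and the lost
factor `N` is exactly what Cauchy–Schwarz costs in `(∑ ‖v i‖)² ≤ N ∑ ‖v i‖²`. -/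
theorem sum_design_mul_norm_centredSum_sq_le (v : Fin N → E) {C : ℝ} (hC : 0 ≤ C)
    (hΔ : ∀ i j, i ≠ j → (N : ℝ) * |S.incl₂ i j - S.incl i * S.incl j| ≤ C) :
    ∑ A, (S.design A).toReal * ‖S.centredSum v A‖ ^ 2 ≤ (1 + C) * ∑ i, ‖v i‖ ^ 2 := by
  rw [sum_design_mul_norm_centredSum_sq]
  have hterm : ∀ i j, (S.incl₂ i j - S.incl i * S.incl j) * inner ℝ (v i) (v j) ≤
      (if i = j then ‖v i‖ ^ 2 else 0) + C / N * (‖v i‖ * ‖v j‖) := by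
    intro i j
    have hN : (0 : ℝ) < N := Nat.cast_pos.2 (Fin.pos i)
    by_cases h : i = j
    · subst h
      rw [if_pos rfl, incl₂_self, real_inner_self_eq_norm_sq]
      have h0 : 0 ≤ S.incl i := S.prob_nonneg _
      have h1 := S.incl_le_one i
      have h2 : S.incl i - S.incl i * S.incl i ≤ 1 := by nlinarith
      have h3 : 0 ≤ C / N * (‖v i‖ * ‖v i‖) := by positivity
      have h4 := mul_le_mul_of_nonneg_right h2 (sq_nonneg ‖v i‖)
      linarith
    · rw [if_neg h, zero_add]
      refine (le_abs_self _).trans ?_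
      rw [abs_mul]
      have h1 : |S.incl₂ i j - S.incl i * S.incl j| ≤ C / N := by
        rw [le_div_iff₀ hN, mul_comm]; exact hΔ i j h
      exact mul_le_mul h1 (abs_real_inner_le_norm _ _) (abs_nonneg _) (by positivity)
  refine (Finset.sum_le_sum fun i _ => Finset.sum_le_sum fun j _ => hterm i j).trans ?_
  simp only [Finset.sum_add_distrib, Finset.sum_ite_eq, Finset.mem_univ, if_true,
    ← Finset.mul_sum]
  rw [← Finset.sum_mul, add_mul, one_mul]
  suffices h : C / N * ((∑ i, ‖v i‖) * ∑ i, ‖v i‖) ≤ C * ∑ i, ‖v i‖ ^ 2 by linarith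
  rcases Nat.eq_zero_or_pos N with h | h
  · subst h; simp
  have hN : (0 : ℝ) < N := Nat.cast_pos.2 h
  have hcs := sq_sum_le_card_mul_sum_sq (s := Finset.univ) (f := fun i => ‖v i‖)
  rw [Finset.card_univ, Fintype.card_fin] at hcs
  rw [← pow_two]
  refine (mul_le_mul_of_nonneg_left hcs (by positivity)).trans_eq ?_
  field_simp

/-- Chebyshev's inequality for centred sums over the sample. -/
theorem prob_norm_centredSum_gt_le (v : Fin N → E) {C B K : ℝ} (hC : 0 ≤ C) (hK : 0 < K)
    (hN : 0 < N)
    (hΔ : ∀ i j, i ≠ j → (N : ℝ) * |S.incl₂ i j - S.incl i * S.incl j| ≤ C)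
    (hv : ∑ i, ‖v i‖ ^ 2 ≤ B * N) :
    S.prob {A | K * √N < ‖S.centredSum v A‖} ≤ (1 + C) * B / K ^ 2 := by
  have hN' : (0 : ℝ) < N := Nat.cast_pos.2 hN
  have h1 : {A | K * √N < ‖S.centredSum v A‖} ⊆
      {A | K ^ 2 * N < ‖S.centredSum v A‖ ^ 2} := by
    intro A hA
    simp only [Set.mem_ofPred_eq] at hA ⊢
    have := pow_lt_pow_left₀ hA (by positivity) two_ne_zero
    rwa [mul_pow, Real.sq_sqrt hN'.le] at this
  have h2 := S.prob_mul_le_sum (X := fun A => ‖S.centredSum v A‖ ^ 2) (fun A => sq_nonneg _)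
    (t := K ^ 2 * N)
  have h3 := (h2.trans (S.sum_design_mul_norm_centredSum_sq_le v hC hΔ)).trans
    (mul_le_mul_of_nonneg_left hv (by positivity))
  refine (S.prob_mono h1).trans ?_
  rw [le_div_iff₀ (by positivity)]
  refine le_of_mul_le_mul_right ?_ hN'
  rw [mul_assoc, mul_assoc (1 + C)]
  exact h3

end Survey

/-! ### Optimality conditions and the Euclidean form of the problem -/

theorem StrictConvexOn.tangent_lt {V : Set ℝ} {G : ℝ → ℝ} (hG : StrictConvexOn ℝ V G) {v w : ℝ}
    (hv : v ∈ V) (hd : DifferentiableAt ℝ G v) (hw : w ∈ V) (hne : w ≠ v) :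
    G v + deriv G v * (w - v) < G w := by
  rcases lt_or_gt_of_ne hne with h | h
  · have := hG.slope_lt_deriv hw hv h hd
    rw [slope_def_field, div_lt_iff₀ (by linarith)] at this
    linarith
  · have := hG.deriv_lt_slope hv hw h hd
    rw [slope_def_field, lt_div_iff₀ (by linarith)] at this
    linarith

/-- The vector of products `v k * v l`. -/
noncomputable def outerSquare {κ : Type*} (v : EuclideanSpace ℝ κ) : EuclideanSpace ℝ (κ × κ) :=
  WithLp.toLp 2 fun q => v q.1 * v q.2

/-- This makes the quadratic form `v ↦ ∑ ⟨z_i, v⟩²` linear in `outerSquare v`, so that a norm bound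
on a single random vector controls all directions `v` at once. -/
theorem inner_outerSquare {κ : Type*} [Fintype κ] (v w : EuclideanSpace ℝ κ) :
    inner ℝ (outerSquare v) (outerSquare w) = inner ℝ v w ^ 2 := by
  simp only [outerSquare, PiLp.inner_apply, RCLike.inner_apply, conj_trivial,
    Fintype.sum_prod_type, pow_two, Finset.sum_mul_sum]
  refine Finset.sum_congr rfl fun k _ => Finset.sum_congr rfl fun l _ => by ring

theorem norm_outerSquare {κ : Type*} [Fintype κ] (v : EuclideanSpace ℝ κ) :
    ‖outerSquare v‖ = ‖v‖ ^ 2 := by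
  have h : ‖outerSquare v‖ ^ 2 = (‖v‖ ^ 2) ^ 2 := by
    rw [← real_inner_self_eq_norm_sq, inner_outerSquare, real_inner_self_eq_norm_sq]
  exact (pow_left_inj₀ (norm_nonneg _) (by positivity) two_ne_zero).1 h

namespace Survey

variable {N p : ℕ} (S : Survey N p) (G : ℝ → ℝ)

/-- The augmented covariate as a vector of the Euclidean space. -/
noncomputable def zVec (i : Fin N) : EuclideanSpace ℝ (Fin (p + 1)) := WithLp.toLp 2 (S.z G i)

/-- The regression coefficient as a vector of the Euclidean space. -/
noncomputable def gammaVec : EuclideanSpace ℝ (Fin (p + 1)) := WithLp.toLp 2 (S.gammaN G)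

/-- The residual `y_i - z_iᵀ γ_N`. -/
noncomputable def resid (i : Fin N) : ℝ := S.y i - inner ℝ (S.zVec G i) (S.gammaVec G)

theorem dotProduct_z (i : Fin N) (v : Fin (p + 1) → ℝ) :
    S.z G i ⬝ᵥ v = inner ℝ (S.zVec G i) (WithLp.toLp 2 v) := by
  rw [zVec, EuclideanSpace.inner_toLp_toLp, star_trivial, dotProduct_comm]

theorem mem_feasible_iff (V : Set ℝ) (A : Finset (Fin N)) (ω : A → ℝ) :
    ω ∈ S.feasible G V A ↔
      (∀ i, ω i ∈ V) ∧ ∑ i : A, ω i • S.zVec G i = ∑ i, S.zVec G i := by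
  simp only [feasible, Set.mem_ofPred_eq, zVec, ← WithLp.toLp_smul, ← WithLp.toLp_sum]
  rw [(WithLp.toLp_injective 2).eq_iff]

theorem gregEstimator_eq (A : Finset (Fin N)) :
    S.gregEstimator G A = inner ℝ (∑ i, S.zVec G i) (S.gammaVec G) +
      ∑ i ∈ A, S.d i * S.resid G i := by
  simp only [gregEstimator, dotProduct_z, sum_inner, resid, gammaVec, d, div_eq_inv_mul]

/-- Weights in the interior of `V` that satisfy the constraints and the first-order condition are
the unique solution of the calibration problem. -/
theorem existsUnique_isSolution {V : Set ℝ} {G : ℝ → ℝ} (hG : StrictConvexOn ℝ V G)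
    (A : Finset (Fin N)) (ω : Fin N → ℝ) (l : EuclideanSpace ℝ (Fin (p + 1)))
    (hV : ∀ i ∈ A, ω i ∈ V) (hd : ∀ i ∈ A, DifferentiableAt ℝ G (ω i))
    (hl : ∀ i ∈ A, deriv G (ω i) = inner ℝ (S.zVec G i) l)
    (hsum : ∑ i ∈ A, ω i • S.zVec G i = ∑ i, S.zVec G i) :
    (∃! w : A → ℝ, S.IsSolution G V A w) ∧
      S.calEstimator G V A = ∑ i ∈ A, ω i * S.y i := by
  set ω₀ : A → ℝ := fun i => ω i with hω₀
  have hfeas : ω₀ ∈ S.feasible G V A := by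
    rw [mem_feasible_iff]
    exact ⟨fun i => hV i i.2, 
      (Finset.sum_coe_sort A fun i => ω i • S.zVec G i).trans hsum⟩
  have hlt : ∀ w ∈ S.feasible G V A, w ≠ ω₀ → ∑ i, G (ω₀ i) < ∑ i, G (w i) := by
    intro w hw hne
    rw [mem_feasible_iff] at hw hfeas
    obtain ⟨j, hj⟩ := Function.ne_iff.1 hne
    -- The first-order term is a multiplier paired with the difference of two weighted sums of the
    -- `z_i`, and both weights satisfy the same constraint.
    have h0 : ∑ i : A, deriv G (ω₀ i) * (w i - ω₀ i) = 0 := by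
      have h1 : ∀ i : A, deriv G (ω₀ i) * (w i - ω₀ i) =
          inner ℝ (w i • S.zVec G i - ω₀ i • S.zVec G i) l := by
        intro i
        rw [hω₀, hl i i.2, ← sub_smul, real_inner_smul_left]; ring
      rw [Finset.sum_congr rfl fun i _ => h1 i, ← sum_inner, Finset.sum_sub_distrib, hw.2,
        hfeas.2, sub_self, inner_zero_left]
    have h2 : ∑ i, (G (ω₀ i) + deriv G (ω₀ i) * (w i - ω₀ i)) < ∑ i, G (w i) := by
      refine Finset.sum_lt_sum (fun i _ => ?_) ⟨j, Finset.mem_univ _, ?_⟩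
      · by_cases h : w i = ω₀ i
        · rw [h]; simp
        · exact (hG.tangent_lt (hV i i.2) (hd i i.2) (hw.1 i) h).le
      · exact hG.tangent_lt (hV j j.2) (hd j j.2) (hw.1 j) hj
    rwa [Finset.sum_add_distrib, h0, add_zero] at h2
  have hsol : S.IsSolution G V A ω₀ := by
    refine ⟨hfeas, isMinOn_iff.2 fun w hw => ?_⟩
    by_cases h : w = ω₀
    · rw [h]
    · exact (hlt w hw h).le
  have huniq : ∀ w, S.IsSolution G V A w → w = ω₀ := by
    intro w hw
    by_contra h
    exact absurd (isMinOn_iff.1 hw.2 ω₀ hfeas) (not_le.2 (hlt w hw.1 h))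
  refine ⟨⟨ω₀, hsol, huniq⟩, ?_⟩
  have : S.calWeights G V A = ω₀ := huniq _ (Classical.epsilon_spec ⟨ω₀, hsol⟩)
  rw [calEstimator, this, ← Finset.sum_coe_sort A fun i => ω i * S.y i]

/-! ### Regular surveys and their regression coefficient -/

/-- Bounds on a survey, in terms of its size `N`. -/
structure Regular (a b c B : ℝ) : Prop where
  pos : 0 < N
  d_mem : ∀ i, S.d i ∈ Set.Icc a b
  gram : ∀ v, c * N * ‖v‖ ^ 2 ≤ ∑ i, inner ℝ (S.zVec G i) v ^ 2
  z_moment : ∑ i, ‖S.zVec G i‖ ^ 4 ≤ B * N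
  y_moment : ∑ i, S.y i ^ 4 ≤ B * N

/-- The sample `A` is representative, up to errors of order `√N`. -/
structure Good (K : ℝ) (A : Finset (Fin N)) : Prop where
  z_le : ‖S.centredSum (fun i => S.d i • S.zVec G i) A‖ ≤ K * √N
  gram_le : ‖S.centredSum (fun i => outerSquare (S.zVec G i)) A‖ ≤ K * √N
  score_le : ‖S.centredSum
    (fun i => (S.resid G i / deriv (deriv G) (S.d i)) • S.zVec G i) A‖ ≤ K * √N
  resid_le : ‖S.centredSum (fun i => S.d i * S.resid G i) A‖ ≤ K * √N

variable {S G} {a b c B : ℝ}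

namespace Regular

variable (h : S.Regular G a b c B)
include h

theorem incl_pos (ha : 0 < a) (i : Fin N) : 0 < S.incl i := by
  have := ha.trans_le (h.d_mem i).1
  rwa [d, inv_pos] at this

theorem inv_le_incl (ha : 0 < a) (i : Fin N) : b⁻¹ ≤ S.incl i := by
  have := (h.d_mem i).2
  rw [d] at this
  exact inv_le_of_inv_le₀ (h.incl_pos ha i) this

theorem sum_incl_smul_d_smul {E : Type*} [AddCommGroup E] [Module ℝ E] (ha : 0 < a)
    (v : Fin N → E) : ∑ i, S.incl i • S.d i • v i = ∑ i, v i := by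
  refine Finset.sum_congr rfl fun i _ => ?_
  rw [smul_smul, d, mul_inv_cancel₀ (h.incl_pos ha i).ne', one_smul]

theorem nat_pos : (0 : ℝ) < N := Nat.cast_pos.2 h.pos

theorem bound_nonneg : 0 ≤ B := by
  have := h.z_moment.trans' (Finset.sum_nonneg fun i _ => by positivity)
  exact nonneg_of_mul_nonneg_left this h.nat_pos

theorem sum_norm_z_sq_le : ∑ i, ‖S.zVec G i‖ ^ 2 ≤ (1 + B) * N := by
  calc ∑ i, ‖S.zVec G i‖ ^ 2 ≤ ∑ i, (1 + ‖S.zVec G i‖ ^ 4) :=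
        Finset.sum_le_sum fun i _ => by nlinarith [sq_nonneg (‖S.zVec G i‖ ^ 2 - 1)]
    _ ≤ (1 + B) * N := by
        rw [Finset.sum_add_distrib]
        have := h.z_moment
        simp; linarith

/-- The quadratic form of `regGram` is bounded below. -/
theorem weightedGram_ge {r : ℝ} (hr : 0 ≤ r) {q : Fin N → ℝ} (hq : ∀ i, r ≤ q i)
    (v : EuclideanSpace ℝ (Fin (p + 1))) :
    r * c * N * ‖v‖ ^ 2 ≤ ∑ i, q i * inner ℝ (S.zVec G i) v ^ 2 := by
  have h1 := mul_le_mul_of_nonneg_left (h.gram v) hr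
  rw [Finset.mul_sum] at h1
  calc _ = r * (c * N * ‖v‖ ^ 2) := by ring
    _ ≤ _ := h1
    _ ≤ _ := Finset.sum_le_sum fun i _ => mul_le_mul_of_nonneg_right (hq i) (sq_nonneg _)

omit h in
theorem regGram_mulVec (S : Survey N p) (G : ℝ → ℝ) (v : Fin (p + 1) → ℝ) :
    S.regGram G *ᵥ v = ∑ i, (S.incl i / deriv (deriv G) (S.d i) *
      inner ℝ (S.zVec G i) (WithLp.toLp 2 v)) • S.z G i := by
  rw [regGram, Matrix.sum_mulVec]
  refine Finset.sum_congr rfl fun i _ => ?_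
  rw [Matrix.smul_mulVec, vecMulVec_mulVec, dotProduct_z, mul_smul]
  simp

/-- A nonzero kernel vector would annihilate a quadratic form bounded below by `r c N ‖v‖²`. -/
theorem isUnit_det_regGram (hc : 0 < c) {r : ℝ} (hr : 0 < r)
    (hq : ∀ i, r ≤ S.incl i / deriv (deriv G) (S.d i)) : IsUnit (S.regGram G).det := by
  rw [isUnit_iff_ne_zero]
  intro h0
  obtain ⟨v, hv, hv0⟩ := Matrix.exists_mulVec_eq_zero_iff.2 h0
  have h1 := h.weightedGram_ge hr.le hq (WithLp.toLp 2 v)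
  have h2 : ∑ i, S.incl i / deriv (deriv G) (S.d i) *
      inner ℝ (S.zVec G i) (WithLp.toLp 2 v) ^ 2 = S.regGram G *ᵥ v ⬝ᵥ v := by
    rw [regGram_mulVec, sum_dotProduct]
    refine Finset.sum_congr rfl fun i _ => ?_
    rw [smul_dotProduct, dotProduct_z, smul_eq_mul]; ring
  rw [h2, hv0, zero_dotProduct] at h1
  have h3 : 0 < ‖(WithLp.toLp 2 v : EuclideanSpace ℝ (Fin (p + 1)))‖ := by
    rw [norm_pos_iff]
    intro h4
    exact hv (by simpa using h4)
  have h4 := h.nat_pos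
  have : 0 < r * c * N * ‖(WithLp.toLp 2 v : EuclideanSpace ℝ (Fin (p + 1)))‖ ^ 2 := by positivity
  linarith

/-- The normal equation of the regression. -/
theorem sum_incl_smul_score (hc : 0 < c) {r : ℝ} (hr : 0 < r)
    (hq : ∀ i, r ≤ S.incl i / deriv (deriv G) (S.d i)) :
    ∑ i, S.incl i • (S.resid G i / deriv (deriv G) (S.d i)) • S.zVec G i = 0 := by
  have h1 : S.regGram G *ᵥ S.gammaN G =
      ∑ i, (S.incl i / deriv (deriv G) (S.d i) * S.y i) • S.z G i := by
    rw [gammaN, Matrix.mulVec_mulVec, Matrix.mul_nonsing_inv _ (h.isUnit_det_regGram hc hr hq),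
      Matrix.one_mulVec]
  rw [regGram_mulVec] at h1
  have h2 := congrArg (WithLp.toLp 2) h1
  simp only [WithLp.toLp_sum, WithLp.toLp_smul] at h2
  rw [← sub_eq_zero, ← neg_eq_zero, neg_sub, ← Finset.sum_sub_distrib] at h2
  rw [← h2]
  refine Finset.sum_congr rfl fun i _ => ?_
  rw [← sub_smul, smul_smul, resid]
  change _ = _ • S.zVec G i
  congr 1
  rw [gammaVec]; ring

/-- The normal equation is paired with `γ` itself: the quadratic side is at least `r c N ‖γ‖²`,
while the fourth moments bound the cross term by `R (1 + B) N ‖γ‖`. -/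
theorem norm_gammaVec_le (hc : 0 < c) {r R : ℝ} (hr : 0 < r)
    (hq : ∀ i, r ≤ S.incl i / deriv (deriv G) (S.d i))
    (hR : ∀ i, S.incl i / deriv (deriv G) (S.d i) ≤ R) :
    ‖S.gammaVec G‖ ≤ R * (1 + B) / (r * c) := by
  have hN := h.nat_pos
  have hB := h.bound_nonneg
  have hR0 : 0 < R := hr.trans_le ((hq ⟨0, h.pos⟩).trans (hR ⟨0, h.pos⟩))
  set γ := S.gammaVec G with hγ
  have h1 := congrArg (fun v => inner ℝ v γ) (h.sum_incl_smul_score hc hr hq)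
  simp only [sum_inner, real_inner_smul_left, inner_zero_left] at h1
  have h2 : ∑ i, S.incl i / deriv (deriv G) (S.d i) * inner ℝ (S.zVec G i) γ ^ 2 =
      ∑ i, S.incl i / deriv (deriv G) (S.d i) * (S.y i * inner ℝ (S.zVec G i) γ) := by
    rw [← sub_eq_zero, ← neg_eq_zero, ← h1, neg_sub, ← Finset.sum_sub_distrib]
    refine Finset.sum_congr rfl fun i _ => ?_
    rw [resid]; ring
  have h3 := h.weightedGram_ge hr.le hq γ
  rw [h2] at h3
  have h4 : ∑ i, S.incl i / deriv (deriv G) (S.d i) * (S.y i * inner ℝ (S.zVec G i) γ) ≤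
      R * (1 + B) * N * ‖γ‖ := by
    have h5 : ∑ i, (|S.y i| * ‖S.zVec G i‖) ≤ (1 + B) * N := by
      calc ∑ i, (|S.y i| * ‖S.zVec G i‖) ≤ ∑ i, (1 + S.y i ^ 4 / 2 + ‖S.zVec G i‖ ^ 4 / 2) := by
            refine Finset.sum_le_sum fun i _ => ?_
            have e1 : S.y i ^ 4 = |S.y i| ^ 4 := (Even.pow_abs (by decide) _).symm
            rw [e1]
            nlinarith [sq_nonneg (|S.y i| - ‖S.zVec G i‖), sq_nonneg (|S.y i| ^ 2 - 1),
              sq_nonneg (‖S.zVec G i‖ ^ 2 - 1)]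
        _ ≤ (1 + B) * N := by
            rw [Finset.sum_add_distrib, Finset.sum_add_distrib, ← Finset.sum_div,
              ← Finset.sum_div]
            have h6 := h.z_moment
            have h7 := h.y_moment
            simp; linarith
    calc _ ≤ ∑ i, R * (|S.y i| * ‖S.zVec G i‖ * ‖γ‖) := by
          refine Finset.sum_le_sum fun i _ => ?_
          refine (le_abs_self _).trans ?_
          rw [abs_mul, abs_mul, mul_assoc]
          refine mul_le_mul ?_ ?_ (by positivity) hR0.le
          · rw [abs_of_nonneg (hr.le.trans (hq i))]; exact hR i
          · exact mul_le_mul_of_nonneg_left (abs_real_inner_le_norm _ _) (abs_nonneg _)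
      _ = R * (∑ i, |S.y i| * ‖S.zVec G i‖) * ‖γ‖ := by
          rw [← Finset.mul_sum, ← Finset.sum_mul, mul_assoc]
      _ ≤ _ := by
          rw [mul_assoc R (1 + B)]
          gcongr
  rw [le_div_iff₀ (by positivity)]
  rcases (norm_nonneg γ).eq_or_lt with h0 | h0
  · rw [← h0, zero_mul]; positivity
  · refine le_of_mul_le_mul_right ?_ (mul_pos hN h0)
    linarith [h3.trans h4]

/-- Convexity of the fourth power, `(s - t)⁴ ≤ 8 (s⁴ + t⁴)`. Fourth moments of residuals are needed
because the score multiplies residuals by `z_i` and its variance involves their squares. -/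
theorem sum_resid_pow_le {Γ : ℝ} (hΓ : ‖S.gammaVec G‖ ≤ Γ) :
    ∑ i, S.resid G i ^ 4 ≤ 8 * (1 + Γ ^ 4) * B * N := by
  calc ∑ i, S.resid G i ^ 4 ≤ ∑ i, 8 * (S.y i ^ 4 + Γ ^ 4 * ‖S.zVec G i‖ ^ 4) := by
        refine Finset.sum_le_sum fun i _ => ?_
        have h1 : inner ℝ (S.zVec G i) (S.gammaVec G) ^ 4 ≤ Γ ^ 4 * ‖S.zVec G i‖ ^ 4 := by
          rw [← mul_pow, ← Even.pow_abs (by decide : Even 4)]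
          refine pow_le_pow_left₀ (abs_nonneg _) ((abs_real_inner_le_norm _ _).trans ?_) 4
          rw [mul_comm]
          gcongr
        have h2 : S.resid G i ^ 4 ≤
            8 * (S.y i ^ 4 + inner ℝ (S.zVec G i) (S.gammaVec G) ^ 4) := by
          rw [resid]
          generalize inner ℝ (S.zVec G i) (S.gammaVec G) = t
          generalize S.y i = s
          have e1 : (s - t) ^ 2 ≤ 2 * (s ^ 2 + t ^ 2) := by nlinarith [sq_nonneg (s + t)]
          have e2 := pow_le_pow_left₀ (sq_nonneg _) e1 2
          nlinarith [sq_nonneg (s ^ 2 - t ^ 2)]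
        linarith
    _ = 8 * (∑ i, S.y i ^ 4 + Γ ^ 4 * ∑ i, ‖S.zVec G i‖ ^ 4) := by
        rw [← Finset.mul_sum, Finset.sum_add_distrib, Finset.mul_sum]
    _ ≤ 8 * (B * N + Γ ^ 4 * (B * N)) := by
        gcongr
        · exact h.y_moment
        · exact h.z_moment
    _ = _ := by ring

end Regular

end Survey

/-! ### Representative samples and the expansion on them -/

namespace Survey

variable {N p : ℕ} {S : Survey N p} {G : ℝ → ℝ} {a b c B : ℝ}

namespace Regular

variable (h : S.Regular G a b c B)
include h

/-- Samples are representative with large probability. -/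
theorem prob_not_good_le (ha : 0 < a) {C K Γ Q : ℝ} (hC : 0 ≤ C) (hK : 0 < K)
    (hΔ : ∀ i j, i ≠ j → (N : ℝ) * |S.incl₂ i j - S.incl i * S.incl j| ≤ C)
    (hΓ : ‖S.gammaVec G‖ ≤ Γ) (hQ : ∀ i, |(deriv (deriv G) (S.d i))⁻¹| ≤ Q) :
    S.prob {A | ¬ S.Good G K A} ≤
      4 * ((1 + C) * ((b ^ 2 + Q ^ 2 + 1) * (1 + B + 8 * (1 + Γ ^ 4) * B)) / K ^ 2) := by
  set B' := 8 * (1 + Γ ^ 4) * B with hB'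
  have hB := h.bound_nonneg
  have hN := h.nat_pos
  have hB'0 : 0 ≤ B' := by positivity
  -- One second-moment bound serves all four sums: their squared coefficients are at most `b²`, `1`,
  -- `Q²` and `b²`.
  have hW : ∀ (m s : Fin N → ℝ) (t : ℝ), t ≤ b ^ 2 + Q ^ 2 + 1 → (∀ i, 0 ≤ s i) →
      (∀ i, m i ≤ t * s i) → ∑ i, s i ≤ (1 + B + B') * N →
      ∑ i, m i ≤ (b ^ 2 + Q ^ 2 + 1) * (1 + B + B') * N := by
    intro m s t ht hs hm hsB
    refine (Finset.sum_le_sum fun i _ => hm i).trans ?_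
    rw [← Finset.mul_sum, mul_assoc (b ^ 2 + Q ^ 2 + 1)]
    exact mul_le_mul ht hsB (Finset.sum_nonneg fun i _ => hs i) (by positivity)
  have hd : ∀ i, S.d i ^ 2 ≤ b ^ 2 := fun i =>
    pow_le_pow_left₀ (ha.le.trans (h.d_mem i).1) (h.d_mem i).2 2
  have hr := h.sum_resid_pow_le hΓ
  have hz := h.z_moment
  have hz2 := h.sum_norm_z_sq_le
  have hBN : 0 ≤ B * N := by positivity
  have hBN' : 0 ≤ B' * N := by positivity
  have hr2 : ∑ i, S.resid G i ^ 2 ≤ (1 + B + B') * N := by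
    calc ∑ i, S.resid G i ^ 2 ≤ ∑ i, (1 + S.resid G i ^ 4) :=
          Finset.sum_le_sum fun i _ => by nlinarith [sq_nonneg (S.resid G i ^ 2 - 1)]
      _ ≤ _ := by rw [Finset.sum_add_distrib]; simp; linarith
  have hrz : ∑ i, S.resid G i ^ 2 * ‖S.zVec G i‖ ^ 2 ≤ (1 + B + B') * N := by
    calc ∑ i, S.resid G i ^ 2 * ‖S.zVec G i‖ ^ 2 ≤
          ∑ i, (S.resid G i ^ 4 / 2 + ‖S.zVec G i‖ ^ 4 / 2) :=
          Finset.sum_le_sum fun i _ => by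
            nlinarith [sq_nonneg (S.resid G i ^ 2 - ‖S.zVec G i‖ ^ 2)]
      _ ≤ _ := by
          rw [Finset.sum_add_distrib, ← Finset.sum_div, ← Finset.sum_div]; linarith
  have hb2 := sq_nonneg b
  have hQ2 := sq_nonneg Q
  have h1 := S.prob_norm_centredSum_gt_le (fun i => S.d i • S.zVec G i) hC hK h.pos hΔ
    (hW _ (fun i => ‖S.zVec G i‖ ^ 2) (b ^ 2) (by linarith) (fun i => by positivity)
      (fun i => by
        rw [norm_smul, mul_pow, Real.norm_eq_abs, sq_abs]
        exact mul_le_mul_of_nonneg_right (hd i) (sq_nonneg _)) (by linarith))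
  have h2 := S.prob_norm_centredSum_gt_le (fun i => outerSquare (S.zVec G i)) hC hK h.pos hΔ
    (hW _ (fun i => ‖S.zVec G i‖ ^ 4) 1 (by linarith) (fun i => by positivity)
      (fun i => le_of_eq (by rw [norm_outerSquare]; ring)) (by linarith))
  have h3 := S.prob_norm_centredSum_gt_le
    (fun i => (S.resid G i / deriv (deriv G) (S.d i)) • S.zVec G i) hC hK h.pos hΔ
    (hW _ (fun i => S.resid G i ^ 2 * ‖S.zVec G i‖ ^ 2) (Q ^ 2) (by linarith)
      (fun i => by positivity) (fun i => by
        have e := pow_le_pow_left₀ (abs_nonneg _) (hQ i) 2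
        rw [norm_smul, mul_pow, Real.norm_eq_abs, sq_abs, div_eq_inv_mul, mul_pow, mul_assoc]
        rw [sq_abs] at e
        exact mul_le_mul_of_nonneg_right e (by positivity)) hrz)
  have h4 := S.prob_norm_centredSum_gt_le (fun i => S.d i * S.resid G i) hC hK h.pos hΔ
    (hW _ (fun i => S.resid G i ^ 2) (b ^ 2) (by linarith) (fun i => by positivity)
      (fun i => by
        rw [Real.norm_eq_abs, sq_abs, mul_pow]
        exact mul_le_mul_of_nonneg_right (hd i) (sq_nonneg _)) hr2)
  refine (S.prob_mono (F := ((_ ∪ _) ∪ (_ ∪ _))) ?_).trans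
    ((S.prob_union_le _ _).trans (add_le_add ((S.prob_union_le _ _).trans (add_le_add h1 h2))
      ((S.prob_union_le _ _).trans (add_le_add h3 h4)))) |>.trans_eq ?_
  · intro A hA
    simp only [Set.mem_union, Set.mem_ofPred_eq] at hA ⊢
    by_contra hcon
    push Not at hcon
    exact hA ⟨hcon.1.1, hcon.1.2, hcon.2.1, hcon.2.2⟩
  · ring

/-- The Gram matrix of a representative sample is bounded below. -/
theorem sampleGram_ge (ha : 0 < a) (hb : 0 < b) {K : ℝ} {A : Finset (Fin N)}
    (hA : S.Good G K A) (hK : 2 * K ≤ b⁻¹ * c * √N) (v : EuclideanSpace ℝ (Fin (p + 1))) :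
    b⁻¹ * c / 2 * N * ‖v‖ ^ 2 ≤ ∑ i ∈ A, inner ℝ (S.zVec G i) v ^ 2 := by
  have h1 := h.weightedGram_ge (inv_nonneg.2 hb.le) (h.inv_le_incl ha) v
  have h2 : ∑ i ∈ A, inner ℝ (S.zVec G i) v ^ 2 =
      inner ℝ (S.centredSum (fun i => outerSquare (S.zVec G i)) A) (outerSquare v) +
        ∑ i, S.incl i * inner ℝ (S.zVec G i) v ^ 2 := by
    simp only [centredSum, inner_sub_left, sum_inner, real_inner_smul_left, inner_outerSquare]
    ring
  have h3 := abs_real_inner_le_norm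
    (S.centredSum (fun i => outerSquare (S.zVec G i)) A) (outerSquare v)
  rw [norm_outerSquare] at h3
  have h4 := h3.trans (mul_le_mul_of_nonneg_right hA.gram_le (sq_nonneg ‖v‖))
  -- The hypothesis on `K` makes the sampling error consume at most half of the population lower
  -- bound.
  have h5 : K * √N ≤ b⁻¹ * c / 2 * N := by
    have h6 := mul_le_mul_of_nonneg_right hK (Real.sqrt_nonneg N)
    rw [mul_assoc _ (√(N : ℝ)) (√N), Real.mul_self_sqrt h.nat_pos.le] at h6
    linarith
  have h7 := mul_le_mul_of_nonneg_right h5 (sq_nonneg ‖v‖)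
  rw [h2]
  linarith [neg_abs_le
    (inner ℝ (S.centredSum (fun i => outerSquare (S.zVec G i)) A) (outerSquare v))]

/-- With `γ_N` fixed by the population, the regression estimator is design-unbiased, and its error
is exactly the centred sum of `d_i e_i`. -/
theorem abs_gregEstimator_sub_total_le (ha : 0 < a) {K : ℝ} {A : Finset (Fin N)}
    (hA : S.Good G K A) : |S.gregEstimator G A - S.total| ≤ K * √N := by
  have h1 : S.gregEstimator G A - S.total = S.centredSum (fun i => S.d i * S.resid G i) A := by
    have h2 := h.sum_incl_smul_d_smul ha (S.resid G)
    simp only [smul_eq_mul] at h2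
    rw [gregEstimator_eq, centredSum, total]
    simp only [smul_eq_mul, h2]
    simp only [resid, Finset.sum_sub_distrib, sum_inner]
    ring
  rw [h1]
  exact hA.resid_le

/-- Existence, uniqueness and expansion of the calibration weights on representative samples. -/
theorem calibration_of_good {V : Set ℝ} (hG : StrictConvexOn ℝ V G) (ha : 0 < a) (hb : 0 < b)
    (hc : 0 < c) {r : ℝ} (hr : 0 < r)
    (hq : ∀ i, r ≤ S.incl i / deriv (deriv G) (S.d i))
    {f : ℝ → ℝ} {κ L η ε τ K Γ : ℝ} (hκ : 0 < κ) (hL : 0 < L)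
    (hJ : Set.Icc (a - η) (b + η) ⊆ V)
    (hdiff : ∀ w ∈ Set.Icc (a - η) (b + η), DifferentiableAt ℝ G w)
    (hf : ∀ u u', κ * (u' - u) ^ 2 ≤ (f u' - f u) * (u' - u) ∧ |f u' - f u| ≤ L * |u' - u|)
    (hfg : ∀ w ∈ Set.Icc a b, f (deriv G w) = w) (hε : 0 < ε) (hτ : 0 < τ)
    (hexp : ∀ w ∈ Set.Icc a b, ∀ t, |t| ≤ τ →
      f (deriv G w + t) ∈ Set.Icc (a - η) (b + η) ∧
      deriv G (f (deriv G w + t)) = deriv G w + t ∧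
      |f (deriv G w + t) - w - t / deriv (deriv G) w| ≤ ε * |t|)
    (hΓ : ‖S.gammaVec G‖ ≤ Γ) (hK : 0 < K) {A : Finset (Fin N)} (hA : S.Good G K A)
    (hN1 : 2 * K ≤ b⁻¹ * c * √N)
    (hN2 : B * (K / (κ * (b⁻¹ * c / 2))) ^ 4 ≤ τ ^ 4 * N) :
    (∃! w : A → ℝ, S.IsSolution G V A w) ∧
      |S.calEstimator G V A - S.gregEstimator G A| ≤
        K * (K / (κ * (b⁻¹ * c / 2))) +
          ε * (K / (κ * (b⁻¹ * c / 2))) * (1 + B + 8 * (1 + Γ ^ 4) * B) * √N := by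
  have hN := h.nat_pos
  set c' := b⁻¹ * c / 2 with hc'
  have hc'0 : 0 < c' := by positivity
  obtain ⟨δ, hδ, hδle⟩ := exists_dual_solution A (S.zVec G) (fun i => deriv G (S.d i))
    (∑ i, S.zVec G i) hκ hL (mul_pos hc'0 hN) hf (h.sampleGram_ge ha hb hA hN1)
  set K' := K / (κ * c') with hK'
  have hK'0 : 0 < K' := by positivity
  have hsq : √(N : ℝ) * √N = N := Real.mul_self_sqrt hN.le
  have hsq0 : 0 < √(N : ℝ) := Real.sqrt_pos.2 hN
  -- At `δ = 0` the weights are `f (g (d_i)) = d_i`, so the defect in the dual equation is the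
  -- Horvitz–Thompson error of `z`.
  have hδK : ‖δ‖ * √N ≤ K' := by
    have h1 : ∑ i ∈ A, f (deriv G (S.d i)) • S.zVec G i - ∑ i, S.zVec G i =
        S.centredSum (fun i => S.d i • S.zVec G i) A := by
      rw [centredSum, h.sum_incl_smul_d_smul ha]
      congr 1
      exact Finset.sum_congr rfl fun i _ => by rw [hfg _ (h.d_mem i)]
    rw [h1] at hδle
    have h2 := hδle.trans hA.z_le
    rw [hK', le_div_iff₀ (by positivity)]
    refine le_of_mul_le_mul_right ?_ hsq0
    calc _ = κ * (c' * (√(N : ℝ) * √N)) * ‖δ‖ := by ring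
      _ ≤ _ := by rw [hsq]; exact h2
  set t : Fin N → ℝ := fun i => inner ℝ (S.zVec G i) δ with ht
  have htle : ∀ i, |t i| ≤ ‖S.zVec G i‖ * ‖δ‖ := fun i => abs_real_inner_le_norm _ _
  -- A single term of the moment sum gives `‖z_i‖⁴ ≤ B N`, and `‖δ‖⁴ N² ≤ K'⁴`; hence `|t i|⁴ ≤ B
  -- K'⁴ / N`.
  have htτ : ∀ i, |t i| ≤ τ := by
    intro i
    refine le_of_pow_le_pow_left₀ (n := 4) (by norm_num) hτ.le ?_
    have h1 : ‖S.zVec G i‖ ^ 4 ≤ B * N :=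
      (Finset.single_le_sum (f := fun i => ‖S.zVec G i‖ ^ 4) (fun j _ => by positivity)
        (Finset.mem_univ i)).trans h.z_moment
    have h2 := pow_le_pow_left₀ (by positivity) hδK 4
    rw [mul_pow] at h2
    have h3 : √(N : ℝ) ^ 4 = N ^ 2 := by
      calc _ = (√(N : ℝ) * √N) ^ 2 := by ring
        _ = _ := by rw [hsq]
    rw [h3] at h2
    have h4 := pow_le_pow_left₀ (abs_nonneg _) (htle i) 4
    rw [mul_pow] at h4
    refine h4.trans (le_of_mul_le_mul_right ?_ (pow_pos hN 2))
    calc ‖S.zVec G i‖ ^ 4 * ‖δ‖ ^ 4 * (N : ℝ) ^ 2 = ‖S.zVec G i‖ ^ 4 * (‖δ‖ ^ 4 * (N : ℝ) ^ 2) := by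
          ring
      _ ≤ B * N * K' ^ 4 := mul_le_mul h1 h2 (by positivity) (by
          have := h.bound_nonneg; positivity)
      _ = B * K' ^ 4 * N := by ring
      _ ≤ τ ^ 4 * N * N := mul_le_mul_of_nonneg_right hN2 hN.le
      _ = _ := by ring
  set ω : Fin N → ℝ := fun i => f (deriv G (S.d i) + t i) with hω
  have hspec := fun i => hexp _ (h.d_mem i) _ (htτ i)
  -- Here the debiasing covariate enters: it makes `g(d_i)` linear in `z_i`, so the shifted value
  -- `g(d_i) + t i` is again of the form `⟨z_i, λ⟩`.
  have hlast : ∀ i, deriv G (S.d i) =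
      inner ℝ (S.zVec G i) (WithLp.toLp 2 (Pi.single (Fin.last p) 1)) := by
    intro i
    rw [← dotProduct_z]
    simp [z]
  obtain ⟨hex, hcal⟩ := S.existsUnique_isSolution hG A ω
    (WithLp.toLp 2 (Pi.single (Fin.last p) 1) + δ) (fun i _ => hJ (hspec i).1)
    (fun i _ => hdiff _ (hspec i).1)
    (fun i _ => by rw [(hspec i).2.1, inner_add_right, ← hlast]) hδ
  refine ⟨hex, ?_⟩
  -- Replacing `∑_U z_i` by `∑_A ω_i z_i` leaves `∑_A (ω_i - d_i) e_i`, which splits into linear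
  -- part and remainder. The normal equation makes the score sum equal to its centred version.
  have hdecomp : S.calEstimator G V A - S.gregEstimator G A =
      inner ℝ (S.centredSum
        (fun i => (S.resid G i / deriv (deriv G) (S.d i)) • S.zVec G i) A) δ +
      ∑ i ∈ A, (ω i - S.d i - t i / deriv (deriv G) (S.d i)) * S.resid G i := by
    rw [centredSum, h.sum_incl_smul_score hc hr hq, sub_zero, hcal, gregEstimator_eq, ← hδ,
      sum_inner, sum_inner, ← sub_sub, ← Finset.sum_sub_distrib, ← Finset.sum_sub_distrib,
      ← Finset.sum_add_distrib]
    refine Finset.sum_congr rfl fun i _ => ?_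
    rw [real_inner_smul_left, real_inner_smul_left]
    simp only [hω, ht, resid]
    ring
  have hfirst := (abs_real_inner_le_norm (S.centredSum
    (fun i => (S.resid G i / deriv (deriv G) (S.d i)) • S.zVec G i) A) δ).trans
    (mul_le_mul_of_nonneg_right hA.score_le (norm_nonneg δ))
  have hfirst' : K * √N * ‖δ‖ ≤ K * K' := by
    rw [mul_assoc, mul_comm (√(N : ℝ))]
    exact mul_le_mul_of_nonneg_left hδK hK.le
  set B' := 8 * (1 + Γ ^ 4) * B with hB'
  have hze : ∑ i, ‖S.zVec G i‖ * |S.resid G i| ≤ (1 + B + B') * N := by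
    have h1 := h.sum_resid_pow_le hΓ
    have h2 := h.z_moment
    have h3 : 0 ≤ B * N := by have := h.bound_nonneg; positivity
    have h4 : 0 ≤ B' * N := by have := h.bound_nonneg; positivity
    calc _ ≤ ∑ i, (1 + ‖S.zVec G i‖ ^ 4 / 2 + S.resid G i ^ 4 / 2) := by
          refine Finset.sum_le_sum fun i _ => ?_
          have e1 : S.resid G i ^ 4 = |S.resid G i| ^ 4 := (Even.pow_abs (by decide) _).symm
          rw [e1]
          nlinarith [sq_nonneg (|S.resid G i| - ‖S.zVec G i‖), sq_nonneg (|S.resid G i| ^ 2 - 1),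
            sq_nonneg (‖S.zVec G i‖ ^ 2 - 1)]
      _ ≤ _ := by
          rw [Finset.sum_add_distrib, Finset.sum_add_distrib, ← Finset.sum_div,
            ← Finset.sum_div]
          simp; linarith
  have hsecond : |∑ i ∈ A, (ω i - S.d i - t i / deriv (deriv G) (S.d i)) * S.resid G i| ≤
      ε * K' * (1 + B + B') * √N := by
    calc _ ≤ ∑ i ∈ A, ε * ‖δ‖ * (‖S.zVec G i‖ * |S.resid G i|) := by
          refine (Finset.abs_sum_le_sum_abs _ _).trans (Finset.sum_le_sum fun i _ => ?_)
          rw [abs_mul]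
          calc _ ≤ ε * (‖S.zVec G i‖ * ‖δ‖) * |S.resid G i| :=
                mul_le_mul_of_nonneg_right ((hspec i).2.2.trans
                  (mul_le_mul_of_nonneg_left (htle i) hε.le)) (abs_nonneg _)
            _ = _ := by ring
      _ ≤ ∑ i, ε * ‖δ‖ * (‖S.zVec G i‖ * |S.resid G i|) :=
          Finset.sum_le_sum_of_subset_of_nonneg (Finset.subset_univ _)
            fun i _ _ => by positivity
      _ = ε * ‖δ‖ * ∑ i, ‖S.zVec G i‖ * |S.resid G i| := by rw [Finset.mul_sum]
      _ ≤ ε * ‖δ‖ * ((1 + B + B') * N) := mul_le_mul_of_nonneg_left hze (by positivity)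
      _ = ε * (1 + B + B') * √N * (‖δ‖ * √N) := by
          linear_combination (-(ε * ‖δ‖ * (1 + B + B'))) * hsq
      _ ≤ ε * (1 + B + B') * √N * K' := by
          refine mul_le_mul_of_nonneg_left hδK ?_
          have := h.bound_nonneg
          positivity
      _ = _ := by ring
  rw [hdecomp]
  exact (abs_add_le _ _).trans (add_le_add (hfirst.trans hfirst') hsecond)

end Regular

end Survey

/-! ### Uniform bounds along the sequence and choice of constants -/

/-- Matrices near a positive definite one have quadratic forms that are uniformly bounded below. -/
theorem Matrix.PosDef.eventually_quadratic_ge {n : Type*} [Fintype n] [Nonempty n]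
    {M : Matrix n n ℝ} (hM : M.PosDef) :
    ∃ c > 0, ∀ᶠ M' in 𝓝 M, ∀ v : EuclideanSpace ℝ n,
      c * ‖v‖ ^ 2 ≤ (v : n → ℝ) ⬝ᵥ (M' *ᵥ (v : n → ℝ)) := by
  classical
  have hcont : Continuous fun q : Matrix n n ℝ × EuclideanSpace ℝ n =>
      (q.2 : n → ℝ) ⬝ᵥ (q.1 *ᵥ (q.2 : n → ℝ)) := by fun_prop
  have hsph : IsCompact (Metric.sphere (0 : EuclideanSpace ℝ n) 1) := isCompact_sphere _ _
  obtain ⟨v₀, hv₀, hmin⟩ := hsph.exists_isMinOn (NormedSpace.sphere_nonempty.2 zero_le_one)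
    ((hcont.comp (Continuous.prodMk_right M)).continuousOn)
  have hpos : 0 < (v₀ : n → ℝ) ⬝ᵥ (M *ᵥ (v₀ : n → ℝ)) := by
    have hne : (v₀ : n → ℝ) ≠ 0 := by
      intro h0
      have : v₀ = 0 := by ext i; exact congrFun h0 i
      rw [this] at hv₀
      simp at hv₀
    simpa using hM.dotProduct_mulVec_pos hne
  set c := (v₀ : n → ℝ) ⬝ᵥ (M *ᵥ (v₀ : n → ℝ)) with hc
  refine ⟨c / 2, half_pos hpos, ?_⟩
  -- Compactness of the unit sphere turns joint continuity into one neighbourhood of `M` valid for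
  -- all unit vectors; homogeneity then covers the rest.
  have hev := hsph.eventually_forall_of_forall_eventually (x₀ := M)
    (P := fun M' v => c / 2 < (v : n → ℝ) ⬝ᵥ (M' *ᵥ (v : n → ℝ))) fun v hv => by
      refine hcont.continuousAt.eventually_const_lt ?_
      exact (half_lt_self hpos).trans_le (isMinOn_iff.1 hmin v hv)
  filter_upwards [hev] with M' hM' v
  by_cases hv : v = 0
  · subst hv; simp
  have hn : ‖v‖ ≠ 0 := norm_ne_zero_iff.2 hv
  have h1 := hM' (‖v‖⁻¹ • v) (by simp [norm_smul, inv_mul_cancel₀ hn])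
  rw [WithLp.ofLp_smul, Matrix.mulVec_smul, smul_dotProduct, dotProduct_smul, smul_eq_mul,
    smul_eq_mul, ← mul_assoc] at h1
  have h2 : 0 < ‖v‖ ^ 2 := by positivity
  have h3 := mul_lt_mul_of_pos_right h1 h2
  refine h3.le.trans_eq ?_
  field_simp

namespace Survey

variable {p : ℕ}

theorem zGram_quadratic {N : ℕ} (S : Survey N p) (G : ℝ → ℝ)
    (v : EuclideanSpace ℝ (Fin (p + 1))) :
    (v : Fin (p + 1) → ℝ) ⬝ᵥ (S.zGram G *ᵥ (v : Fin (p + 1) → ℝ)) =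
      ∑ i, inner ℝ (S.zVec G i) v ^ 2 := by
  rw [zGram, Matrix.sum_mulVec, dotProduct_sum]
  refine Finset.sum_congr rfl fun i _ => ?_
  rw [vecMulVec_mulVec, dotProduct_z, dotProduct_comm]
  simp only [op_smul_eq_smul, smul_dotProduct, dotProduct_z, smul_eq_mul, pow_two]

theorem norm_zVec_sq {N : ℕ} (S : Survey N p) (G : ℝ → ℝ) (i : Fin N) :
    ‖S.zVec G i‖ ^ 2 = ∑ k, S.x i k ^ 2 + deriv G (S.d i) ^ 2 := by
  rw [EuclideanSpace.real_norm_sq_eq, Fin.sum_univ_castSucc]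
  simp [zVec, z]

/-- Surveys of the sequence are eventually regular. -/
theorem eventually_regular (N : ℕ → ℕ) (hN : Tendsto N atTop atTop) (S : ∀ ν, Survey (N ν) p)
    (G : ℝ → ℝ) {a b : ℝ} (hg : ContinuousOn (deriv G) (Set.Icc a b))
    (hd : ∀ ν i, (S ν).d i ∈ Set.Icc a b)
    (hz : ∃ Sz : Matrix (Fin (p + 1)) (Fin (p + 1)) ℝ, Sz.PosDef ∧
      Tendsto (fun ν => (N ν : ℝ)⁻¹ • (S ν).zGram G) atTop (𝓝 Sz))
    (hmom : ∃ C : ℝ, ∀ᶠ ν in atTop,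
      (∑ i, (√((S ν).y i ^ 2 + ∑ k, (S ν).x i k ^ 2)) ^ 4) / (N ν : ℝ) ≤ C) :
    ∃ c > 0, ∃ B, ∀ᶠ ν in atTop, (S ν).Regular G a b c B := by
  obtain ⟨Sz, hSz, hlim⟩ := hz
  obtain ⟨C, hC⟩ := hmom
  obtain ⟨c, hc, hev⟩ := hSz.eventually_quadratic_ge
  obtain ⟨D, hD⟩ := isCompact_Icc.exists_bound_of_continuousOn hg
  -- `‖z_i‖⁴ = (‖x_i‖² + g(d_i)²)² ≤ 2‖x_i‖⁴ + 2D⁴` yields the first two terms, and the moment of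
  -- `y` yields the last; their sum serves both bounds.
  refine ⟨c, hc, 2 * C + 2 * D ^ 4 + C, ?_⟩
  filter_upwards [hlim.eventually hev, hC, hN.eventually_gt_atTop 0] with ν h1 h2 h3
  have hN0 : (0 : ℝ) < N ν := Nat.cast_pos.2 h3
  rw [div_le_iff₀ hN0] at h2
  have hsq : ∀ i, √((S ν).y i ^ 2 + ∑ k, (S ν).x i k ^ 2) ^ 4 =
      ((S ν).y i ^ 2 + ∑ k, (S ν).x i k ^ 2) ^ 2 := by
    intro i
    have h0 : 0 ≤ (S ν).y i ^ 2 + ∑ k, (S ν).x i k ^ 2 := by positivity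
    calc _ = (√((S ν).y i ^ 2 + ∑ k, (S ν).x i k ^ 2) ^ 2) ^ 2 := by ring
      _ = _ := by rw [Real.sq_sqrt h0]
  simp only [hsq] at h2
  have hX : ∀ i, 0 ≤ ∑ k, (S ν).x i k ^ 2 := fun i => by positivity
  have hCN : 0 ≤ C * N ν := h2.trans' (by positivity)
  have hDN : 0 ≤ D ^ 4 * N ν := by positivity
  refine ⟨h3, hd ν, fun v => ?_, ?_, ?_⟩
  · have h4 := h1 v
    rw [Matrix.smul_mulVec, dotProduct_smul, zGram_quadratic, smul_eq_mul,
      le_inv_mul_iff₀ hN0] at h4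
    linarith
  · calc ∑ i, ‖(S ν).zVec G i‖ ^ 4 ≤
          ∑ i, (2 * ((S ν).y i ^ 2 + ∑ k, (S ν).x i k ^ 2) ^ 2 + 2 * D ^ 4) := by
          refine Finset.sum_le_sum fun i _ => ?_
          have e1 : ‖(S ν).zVec G i‖ ^ 4 = (‖(S ν).zVec G i‖ ^ 2) ^ 2 := by ring
          have e2 : deriv G ((S ν).d i) ^ 4 ≤ D ^ 4 := by
            rw [← Even.pow_abs (by decide : Even 4)]
            exact pow_le_pow_left₀ (abs_nonneg _) (hD _ (hd ν i)) 4
          rw [e1, norm_zVec_sq]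
          nlinarith [sq_nonneg (∑ k, (S ν).x i k ^ 2 - deriv G ((S ν).d i) ^ 2), hX i,
            sq_nonneg ((S ν).y i), mul_nonneg (hX i) (sq_nonneg ((S ν).y i)),
            sq_nonneg ((S ν).y i ^ 2)]
      _ ≤ _ := by
          rw [Finset.sum_add_distrib, ← Finset.mul_sum]
          simp only [Finset.sum_const, Finset.card_univ, Fintype.card_fin, nsmul_eq_mul]
          linarith
  · calc ∑ i, (S ν).y i ^ 4 ≤ ∑ i, ((S ν).y i ^ 2 + ∑ k, (S ν).x i k ^ 2) ^ 2 := by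
          refine Finset.sum_le_sum fun i _ => ?_
          nlinarith [hX i, mul_nonneg (hX i) (sq_nonneg ((S ν).y i)), sq_nonneg (∑ k, (S ν).x i k ^ 2)]
      _ ≤ _ := by linarith

/-- With probability tending to one, the calibration problem has a unique solution, the
calibration estimator is close to the regression estimator, and the latter to the total. -/
theorem eventually_calibration (N : ℕ → ℕ) (hN : Tendsto N atTop atTop)
    (S : ∀ ν, Survey (N ν) p) (V : Set ℝ) (G : ℝ → ℝ)
    (hconv : StrictConvexOn ℝ V G) (hG : ContDiffOn ℝ 2 G V)
    (hG_pos : ∀ w ∈ interior V, 0 < deriv (deriv G) w)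
    (hπ : ∃ c₁ c₂ : ℝ, 0 < c₁ ∧ 0 < c₂ ∧ c₁⁻¹ ∈ interior V ∧ c₂⁻¹ ∈ interior V ∧
      ∀ ν i, c₁ < (S ν).incl i ∧ (S ν).incl i < c₂)
    (hΔ : ∃ C : ℝ, ∀ᶠ ν in atTop, ∀ i j, i ≠ j →
      (N ν : ℝ) * |(S ν).incl₂ i j - (S ν).incl i * (S ν).incl j| ≤ C)
    (hz : ∃ Sz : Matrix (Fin (p + 1)) (Fin (p + 1)) ℝ, Sz.PosDef ∧
      Tendsto (fun ν => (N ν : ℝ)⁻¹ • (S ν).zGram G) atTop (𝓝 Sz))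
    (hmom : ∃ C : ℝ, ∀ᶠ ν in atTop,
      (∑ i, (√((S ν).y i ^ 2 + ∑ k, (S ν).x i k ^ 2)) ^ 4) / (N ν : ℝ) ≤ C) :
    (∀ᶠ ν in atTop, IsUnit ((S ν).regGram G).det) ∧
    ∀ ε > 0, ∀ ρ > 0, ∀ᶠ ν in atTop, (S ν).prob {A | ¬ ((∃! ω : A → ℝ, (S ν).IsSolution G V A ω) ∧
      |(S ν).calEstimator G V A - (S ν).gregEstimator G A| ≤ ε * √(N ν : ℝ) ∧
      |(S ν).gregEstimator G A - (S ν).total| ≤ ε * N ν)} ≤ ρ := by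
  obtain ⟨c₁, c₂, hc₁, hc₂, hbV, haV, hincl⟩ := hπ
  have hNpos := hN.eventually_gt_atTop 0
  obtain ⟨b, hb⟩ : ∃ b, b = c₁⁻¹ := ⟨_, rfl⟩
  obtain ⟨a, ha⟩ : ∃ a, a = c₂⁻¹ := ⟨_, rfl⟩
  rw [← hb] at hbV
  rw [← ha] at haV
  have ha0 : 0 < a := by rw [ha]; positivity
  have hb0 : 0 < b := by rw [hb]; positivity
  have hab : a ≤ b := by
    obtain ⟨ν, hν⟩ := hNpos.exists
    have := hincl ν ⟨0, hν⟩
    rw [ha, hb]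
    exact inv_anti₀ hc₁ (this.1.trans this.2).le
  have hd : ∀ ν i, (S ν).d i ∈ Set.Icc a b := by
    intro ν i
    have := hincl ν i
    rw [ha, hb, d]
    exact ⟨inv_anti₀ (hc₁.trans this.1) this.2.le, inv_anti₀ hc₁ this.1.le⟩
  -- a neighbourhood of the design weights
  obtain ⟨η, hη, hJ⟩ : ∃ η > 0, Set.Icc (a - η) (b + η) ⊆ interior V := by
    obtain ⟨η₁, h₁, hs₁⟩ := Metric.isOpen_iff.1 isOpen_interior _ haV
    obtain ⟨η₂, h₂, hs₂⟩ := Metric.isOpen_iff.1 isOpen_interior _ hbV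
    have hm : 0 < min η₁ η₂ := lt_min h₁ h₂
    refine ⟨min η₁ η₂ / 2, half_pos hm, hconv.1.interior.ordConnected.out (hs₁ ?_) (hs₂ ?_)⟩
    · rw [Metric.mem_ball, Real.dist_eq, sub_sub_cancel_left, abs_neg, abs_of_pos (half_pos hm)]
      linarith [min_le_left η₁ η₂]
    · rw [Metric.mem_ball, Real.dist_eq, add_sub_cancel_left, abs_of_pos (half_pos hm)]
      linarith [min_le_right η₁ η₂]
  have hGi : ContDiffOn ℝ 2 G (interior V) := hG.mono interior_subset
  have hG1 : ContDiffOn ℝ 1 (deriv G) (interior V) :=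
    hGi.deriv_of_isOpen isOpen_interior (by norm_num)
  have hdiff : ∀ w ∈ interior V, DifferentiableAt ℝ G w := fun w hw =>
    (hGi.differentiableOn (by norm_num)).differentiableAt (isOpen_interior.mem_nhds hw)
  have hdiff1 : ∀ w ∈ interior V, HasDerivAt (deriv G) (deriv (deriv G) w) w := fun w hw =>
    ((hG1.differentiableOn (by norm_num)).differentiableAt
      (isOpen_interior.mem_nhds hw)).hasDerivAt
  have hcont2 : ContinuousOn (deriv (deriv G)) (interior V) :=
    hG1.continuousOn_deriv_of_isOpen isOpen_interior (by norm_num)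
  obtain ⟨f, κ, L, hκ, hL, hf, hfg, hexp⟩ := exists_inverse_expansion hab hη
    (fun w hw => hdiff1 w (hJ hw)) (hcont2.mono hJ) (fun w hw => hG_pos w (hJ hw))
  have hsub : Set.Icc a b ⊆ interior V :=
    (Set.Icc_subset_Icc (by linarith) (by linarith)).trans hJ
  obtain ⟨w₀, hw₀, hmin⟩ := isCompact_Icc.exists_isMinOn (Set.nonempty_Icc.2 hab)
    (hcont2.mono hsub)
  obtain ⟨w₁, hw₁, hmax⟩ := isCompact_Icc.exists_isMaxOn (Set.nonempty_Icc.2 hab)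
    (hcont2.mono hsub)
  set m := deriv (deriv G) w₀ with hm
  set M := deriv (deriv G) w₁ with hM
  have hm0 : 0 < m := hG_pos _ (hsub hw₀)
  have hM0 : 0 < M := hG_pos _ (hsub hw₁)
  have hmM : ∀ ν i, m ≤ deriv (deriv G) ((S ν).d i) ∧ deriv (deriv G) ((S ν).d i) ≤ M :=
    fun ν i => ⟨isMinOn_iff.1 hmin _ (hd ν i), isMaxOn_iff.1 hmax _ (hd ν i)⟩
  obtain ⟨c, hc, B, hreg⟩ := eventually_regular N hN S G
    (hG1.continuousOn.mono hsub) hd hz hmom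
  have hr : 0 < b⁻¹ / M := by positivity
  have hq : ∀ ν i, b⁻¹ / M ≤ (S ν).incl i / deriv (deriv G) ((S ν).d i) := fun ν i =>
    div_le_div₀ (hc₁.trans (hincl ν i).1).le (by rw [hb, inv_inv]; exact (hincl ν i).1.le)
      (hm0.trans_le (hmM ν i).1) (hmM ν i).2
  have hR : ∀ ν i, (S ν).incl i / deriv (deriv G) ((S ν).d i) ≤ 1 / m := fun ν i =>
    div_le_div₀ zero_le_one ((S ν).incl_le_one i) hm0 (hmM ν i).1
  have hQ : ∀ ν i, |(deriv (deriv G) ((S ν).d i))⁻¹| ≤ m⁻¹ := fun ν i => by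
    rw [abs_of_pos (inv_pos.2 (hm0.trans_le (hmM ν i).1))]
    exact inv_anti₀ hm0 (hmM ν i).1
  refine ⟨hreg.mono fun ν h => h.isUnit_det_regGram hc hr (hq ν), fun ε hε ρ hρ => ?_⟩
  obtain ⟨C, hC⟩ := hΔ
  have hB : 0 ≤ B := by
    obtain ⟨ν, hν⟩ := hreg.exists
    exact hν.bound_nonneg
  set Γ := 1 / m * (1 + B) / (b⁻¹ / M * c) with hΓ
  set W := 4 * ((1 + max C 0) * ((b ^ 2 + m⁻¹ ^ 2 + 1) * (1 + B + 8 * (1 + Γ ^ 4) * B))) with hW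
  have hW0 : 0 < W := by
    have : 0 ≤ max C 0 := le_max_right _ _
    positivity
  -- The Chebyshev bound on the exceptional probability is `W / K²`, and this choice makes it equal
  -- to `ρ`.
  set K := √(W / ρ) with hKdef
  have hK : 0 < K := Real.sqrt_pos.2 (by positivity)
  have hK2 : W / K ^ 2 = ρ := by
    rw [hKdef, Real.sq_sqrt (by positivity)]
    field_simp
  set K' := K / (κ * (b⁻¹ * c / 2)) with hK'
  have hK'0 : 0 < K' := by positivity
  set D := 1 + B + 8 * (1 + Γ ^ 4) * B with hD
  have hD0 : 0 < D := by positivity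
  -- Only now, with `K'` and `D` fixed, is the Taylor accuracy chosen: the remainder gets `(ε / 2)
  -- √N`, and the other half absorbs the bounded term `K K'` for large `N`.
  set ε₀ := ε / (2 * (K' * D)) with hε₀
  have hε₀0 : 0 < ε₀ := by positivity
  have hε₀2 : ε₀ * K' * D = ε / 2 := by rw [hε₀]; field_simp
  obtain ⟨τ, hτ, hexpτ⟩ := hexp ε₀ hε₀0
  have hNr : Tendsto (fun ν => (N ν : ℝ)) atTop atTop := tendsto_natCast_atTop_atTop.comp hN
  have hsq : Tendsto (fun ν => √(N ν : ℝ)) atTop atTop := Real.tendsto_sqrt_atTop.comp hNr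
  filter_upwards [hreg, hC, (hsq.const_mul_atTop (by positivity : 0 < b⁻¹ * c)).eventually_ge_atTop
    (2 * K), (hNr.const_mul_atTop (pow_pos hτ 4)).eventually_ge_atTop (B * K' ^ 4),
    (hsq.const_mul_atTop (half_pos hε)).eventually_ge_atTop (K * K'),
    (hsq.const_mul_atTop hε).eventually_ge_atTop K] with ν h1 h2 h3 h4 h5 h6
  have hγ : ‖(S ν).gammaVec G‖ ≤ Γ := h1.norm_gammaVec_le hc hr (hq ν) (hR ν)
  have hbad := h1.prob_not_good_le ha0 (le_max_right C 0) hK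
    (fun i j hij => (h2 i j hij).trans (le_max_left _ _)) hγ (hQ ν)
  rw [← mul_div_assoc, ← hW, hK2] at hbad
  refine ((S ν).prob_mono fun A hA => ?_).trans hbad
  simp only [Set.mem_ofPred_eq] at hA ⊢
  refine fun hgood => hA ?_
  obtain ⟨hex, hle⟩ := h1.calibration_of_good hconv ha0 hb0 hc hr (hq ν) hκ hL
    (hJ.trans interior_subset) (fun w hw => hdiff w (hJ hw)) hf hfg hε₀0 hτ hexpτ hγ hK hgood h3 h4
  refine ⟨hex, hle.trans ?_, (h1.abs_gregEstimator_sub_total_le ha0 hgood).trans ?_⟩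
  · rw [hε₀2]
    linarith
  · have h7 := mul_le_mul_of_nonneg_right h6 (Real.sqrt_nonneg (N ν))
    rwa [mul_assoc, Real.mul_self_sqrt (Nat.cast_nonneg _)] at h7

end Survey

/-! ### Convergence in probability -/

theorem tendstoZeroInProb_of_eventually {p : ℕ} {N : ℕ → ℕ} {S : ∀ ν, Survey (N ν) p}
    {T : ∀ ν, Finset (Fin (N ν)) → ℝ}
    (h : ∀ ε > 0, ∀ ρ > 0, ∀ᶠ ν in atTop, (S ν).prob {A | ε < |T ν A|} ≤ ρ) :
    TendstoZeroInProb S T := by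
  intro ε hε
  rw [Metric.tendsto_atTop']
  intro ρ hρ
  obtain ⟨n, hn⟩ := eventually_atTop.1 (h ε hε (ρ / 2) (half_pos hρ))
  refine ⟨n, fun ν hν => ?_⟩
  rw [Real.dist_eq, sub_zero, abs_of_nonneg ((S ν).prob_nonneg _)]
  linarith [hn ν hν.le]

theorem theorem1 {p : ℕ} (N : ℕ → ℕ) (hN : Tendsto N atTop atTop)
    (S : ∀ ν, Survey (N ν) p) (V : Set ℝ) (G : ℝ → ℝ)
    -- the entropy function and its domain
    (hconv : StrictConvexOn ℝ V G) (hG : ContDiffOn ℝ 2 G V)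
    (hG_pos : ∀ w ∈ interior V, 0 < deriv (deriv G) w)
    -- first-order inclusion probabilities
    (hπ : ∃ c₁ c₂ : ℝ, 0 < c₁ ∧ 0 < c₂ ∧ c₁⁻¹ ∈ interior V ∧ c₂⁻¹ ∈ interior V ∧
      ∀ ν i, c₁ < (S ν).incl i ∧ (S ν).incl i < c₂)
    -- weak dependence: `limsup N max_{i ≠ j} |π_ij - π_i π_j| < ∞`
    (hΔ : ∃ C : ℝ, ∀ᶠ ν in atTop, ∀ i j, i ≠ j →
      (N ν : ℝ) * |(S ν).incl₂ i j - (S ν).incl i * (S ν).incl j| ≤ C)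
    -- full rank in the limit, and bounded average fourth moment of `(y_i, x_i)` (Euclidean norm)
    (hz : ∃ Sz : Matrix (Fin (p + 1)) (Fin (p + 1)) ℝ, Sz.PosDef ∧
      Tendsto (fun ν => (N ν : ℝ)⁻¹ • (S ν).zGram G) atTop (𝓝 Sz))
    (hmom : ∃ C : ℝ, ∀ᶠ ν in atTop,
      (∑ i, (√((S ν).y i ^ 2 + ∑ k, (S ν).x i k ^ 2)) ^ 4) / (N ν : ℝ) ≤ C) :
    -- the solution exists and is unique with probability tending to one
    Tendsto (fun ν => (S ν).prob {A | ∃! ω : A → ℝ, (S ν).IsSolution G V A ω}) atTop (𝓝 1) ∧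
    -- the regression coefficient `γ_N` is eventually well defined
    (∀ᶠ ν in atTop, IsUnit ((S ν).regGram G).det) ∧
    -- `θ̂_cal = θ̂_greg + o_p(n^{-1/2} N)`
    TendstoZeroInProb S (fun ν A => √(A.card : ℝ) / (N ν : ℝ) *
      ((S ν).calEstimator G V A - (S ν).gregEstimator G A)) ∧
    -- `θ̂_cal` is design-consistent
    TendstoZeroInProb S (fun ν A => ((S ν).calEstimator G V A - (S ν).total) / (N ν : ℝ)) := by
  obtain ⟨hunit, hmain⟩ := Survey.eventually_calibration N hN S V G hconv hG hG_pos hπ hΔ hz hmom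
  refine ⟨?_, hunit, tendstoZeroInProb_of_eventually fun ε hε ρ hρ => ?_,
    tendstoZeroInProb_of_eventually fun ε hε ρ hρ => ?_⟩
  · rw [Metric.tendsto_atTop']
    intro ρ hρ
    obtain ⟨n, hn⟩ := eventually_atTop.1 (hmain 1 one_pos (ρ / 2) (half_pos hρ))
    refine ⟨n, fun ν hν => ?_⟩
    have h1 := (S ν).prob_add_prob_compl {A | ∃! ω : A → ℝ, (S ν).IsSolution G V A ω}
    have h2 := (S ν).prob_nonneg {A | ∃! ω : A → ℝ, (S ν).IsSolution G V A ω}ᶜ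
    have h3 : (S ν).prob {A | ∃! ω : A → ℝ, (S ν).IsSolution G V A ω}ᶜ ≤ ρ / 2 := by
      refine ((S ν).prob_mono fun A hA => ?_).trans (hn ν hν.le)
      simp only [Set.mem_compl_iff, Set.mem_ofPred_eq] at hA ⊢
      exact fun h => hA h.1
    rw [Real.dist_eq, abs_lt]
    constructor <;> linarith
  · filter_upwards [hmain (ε / 2) (half_pos hε) ρ hρ, hN.eventually_gt_atTop 0] with ν h1 h2
    refine ((S ν).prob_mono fun A hA => ?_).trans h1
    simp only [Set.mem_ofPred_eq] at hA ⊢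
    intro h
    have hN0 : (0 : ℝ) < N ν := Nat.cast_pos.2 h2
    -- Since `n ≤ N`, an error `o_p(√N)` is also `o_p(n^{-1/2} N)`; no lower bound on `n` is needed.
    have hcard : √(A.card : ℝ) ≤ √(N ν : ℝ) := by
      refine Real.sqrt_le_sqrt (Nat.cast_le.2 ?_)
      simpa using Finset.card_le_univ A
    have h3 : |√(A.card : ℝ) / (N ν : ℝ) *
        ((S ν).calEstimator G V A - (S ν).gregEstimator G A)| ≤ ε / 2 := by
      rw [abs_mul, abs_of_nonneg (by positivity), div_mul_eq_mul_div, div_le_iff₀ hN0]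
      calc _ ≤ √(N ν : ℝ) * (ε / 2 * √(N ν : ℝ)) :=
            mul_le_mul hcard h.2.1 (abs_nonneg _) (Real.sqrt_nonneg _)
        _ = ε / 2 * (√(N ν : ℝ) * √(N ν : ℝ)) := by ring
        _ = _ := by rw [Real.mul_self_sqrt hN0.le]
    linarith
  -- The two errors are at most `(ε / 4) √N ≤ (ε / 4) N` and `(ε / 4) N`, whose sum is strictly
  -- below `ε N`.
  · filter_upwards [hmain (ε / 4) (by positivity) ρ hρ, hN.eventually_gt_atTop 0] with ν h1 h2
    refine ((S ν).prob_mono fun A hA => ?_).trans h1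
    simp only [Set.mem_ofPred_eq] at hA ⊢
    intro h
    have hN1 : (1 : ℝ) ≤ N ν := Nat.one_le_cast.2 h2
    have hN0 : (0 : ℝ) < N ν := by linarith
    have hsqrt : √(N ν : ℝ) ≤ N ν := by
      rw [Real.sqrt_le_left hN0.le]
      nlinarith
    rw [abs_div, abs_of_pos hN0, lt_div_iff₀ hN0] at hA
    have h5 := abs_sub_le ((S ν).calEstimator G V A) ((S ν).gregEstimator G A) (S ν).total
    have h6 := mul_le_mul_of_nonneg_left hsqrt (by positivity : 0 ≤ ε / 4)
    have h7 : 0 < ε * N ν := by positivity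
    linarith [h.2.1, h.2.2]
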